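/- Fix $n\ge 1$ and a partition $\lambda=(\lambda_1\ge\dots\ge\lambda_n\ge 0)$ with integer parts, with column lengths $\zeta_1\ge\dots\ge\zeta_{\lambda_1}$. Let $R=\{q_1<\dots<q_r\}\subseteq[n-1]$ be the set of those column lengths that are less than $n$, and put $q_0=0$, $q_{r+1}=n$. The intervals $(q_{h-1},q_h]$, $1\le h\le r+1$, are called carrels. **Tuples.** All tuples have $n$ entries in $[n]$. A tuple $\upsilon$ is *upper* if $\upsilon_i\ge i$ for all $i$; $U$ is the set of upper tuples and $UF$ the set of weakly increasing ones in $U$ (upper flags). A tuple is *$\lambda$-increasing* if it is strictly increasing on each carrel. A *$\lambda$-permutation* is a $\lambda$-increasing permutation of $[n]$; it is *$\lambda$-312-avoiding* if there are no $h$ and $a\le q_h<b\le q_{h+1}<c\le n$ with $\pi_b<\pi_c<\pi_a$. A *gapless $\lambda$-tuple* is a $\lambda$-increasing upper tuple $\gamma$ such that, whenever $1\le h\le r$ and $\gamma_{q_h}>\gamma_{q_h+1}$, the number $s=\gamma_{q_h}-\gamma_{q_h+1}+1$ satisfies $s\le q_{h+1}-q_h$ and the first $s$ entries of $\gamma$ on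 $(q_h,q_{h+1}]$ are $\gamma_{q_h}-s+1,\dots,\gamma_{q_h}$. Let $UG$ be the set of these. A *$\lambda$-floor flag* is an upper flag in which the leftmost index of every maximal constant run of length at least $2$ lies in $R$. **Maps.** For $\upsilon\in U$, the critical indices in a carrel $(q_{h-1},q_h]$ are found from the right: $q_h$ is critical, and if $y$ is critical, then the next critical index is the largest $x\in(q_{h-1},y)$ with $\upsilon_y-\upsilon_x>y-x$, if one exists. The *$\lambda$-core* $\Delta_\lambda(\upsilon)$ has $i$-th entry $\upsilon_x-(x-i)$, where $x$ is the smallest critical index $\ge i$. Let $UGC=\{\eta\in U:\Delta_\lambda(\eta)\in UG\}$. For $\gamma\in UG$, the tuple $\Phi_\lambda(\gamma)$ has $i$-th entry $\gamma_x-(x-i)$, where $x$ is the smallest critical index of $\gamma$ with $x\ge i$, except that when $i<x$ and $x$ is the leftmost critical index of a carrel $(q_h,q_{h+1}]$ with $h\ge 1$, the entry is $\max\{\gamma_{q_h},\gamma_x-(x-i)\}$. For a $\lambda$-permutation $\pi$, $\Psi_\lambda(\pi)_i$ is, for $i\in(q_{h-1},q_h]$, the $(q_h-i+1)$-th largest element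 of $\{\pi_1,\dots,\pi_{q_h}\}$. For $\gamma\in UG$, $\pi=\Pi_\lambda(\gamma)$ is defined by $\pi_i=\gamma_i$ for $i\le q_1$ and then carrel by carrel for $h=1,\dots,r$: put $s=\gamma_{q_h}-\gamma_{q_h+1}+1$ if $\gamma_{q_h}\ge\gamma_{q_h+1}$, and $s=0$ otherwise; for $q_h+s<i\le q_{h+1}$ put $\pi_i=\gamma_i$; for $q_h<i\le q_h+s$ let $\pi_i$ be the $(q_h+s-i+1)$-th largest element of $[\gamma_{q_h}]\setminus\{\pi_1,\dots,\pi_{q_h}\}$. **Tableaux.** Let $\mathcal T_\lambda$ be the set of semistandard tableaux $T$ of shape $\lambda$ with values in $[n]$, ordered entrywise, and let $T_j(i)$ be the value of $T$ in column $j$ and row $i$. The *key* $Y_\lambda(\pi)$ of a $\lambda$-permutation $\pi$ is the tableau of shape $\lambda$ whose $j$-th column consists of the elements of $\{\pi_1,\dots,\pi_{\zeta_j}\}$. The *scanning tableau* $S(T)$ is obtained as follows. For each $j$, consider columns $j,j+1,\dots,\lambda_1$ of $T$ with no box marked, and repeat $\zeta_j$ times: read the lowest unmarked values of those columns that still have unmarked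 boxes, from left to right; form their earliest weakly increasing subsequence (take the first value, then always the next value that is at least the last one taken); mark the boxes of this subsequence; write its last value in the lowest empty box of column $j$ of $S(T)$. The *Demazure set* of $\pi$ is $\mathcal D_\lambda(\pi)=\{T\in\mathcal T_\lambda: S(T)\le Y_\lambda(\pi)\}$. For $\beta\in U$ the *row bound set* is $\mathcal S_\lambda(\beta)=\{T\in\mathcal T_\lambda: T_j(i)\le\beta_i \text{ for all boxes } (j,i)\}$; it is a *flag bound set* if it equals $\mathcal S_\lambda(\varphi)$ for some $\varphi\in UF$. Let $Q_\lambda(\beta)$ be the least upper bound of $\mathcal S_\lambda(\beta)$ in $\mathcal T_\lambda$. **Theorem.** For $\beta\in U$, the set $\mathcal S_\lambda(\beta)$ equals $\mathcal D_\lambda(\pi)$ for some $\lambda$-permutation $\pi$ if and only if $\Delta_\lambda(\beta)\in UG$. Every flag bound set is a Demazure set, and a row bound set is a Demazure set if and only if it is a flag bound set. For a $\lambda$-permutation $\pi$, the set $\mathcal D_\lambda(\pi)$ equals $\mathcal S_\lambda(\beta)$ for some $\beta\in U$ if and only if $\pi$ is $\lambda$-312-avoiding. Specifically: (i) If $\beta\in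 UGC$ and $\pi:=\Pi_\lambda(\Delta_\lambda(\beta))$, then $\pi$ is a $\lambda$-312-avoiding $\lambda$-permutation, $\mathcal S_\lambda(\beta)=\mathcal D_\lambda(\pi)$, and $\pi$ is the only $\lambda$-permutation for which this equality holds. (ii) If $\pi$ is a $\lambda$-312-avoiding $\lambda$-permutation and $\gamma:=\Psi_\lambda(\pi)$, then $\gamma\in UG$ and $\mathcal D_\lambda(\pi)=\mathcal S_\lambda(\gamma)$; and if $\mathcal D_\lambda(\pi)=\mathcal S_\lambda(\beta)$ with $\beta\in U$, then $\Delta_\lambda(\beta)=\gamma$ and $\beta\in UGC$. (iii) If $\beta\in U$ and a $\lambda$-permutation $\pi$ satisfy $\mathcal S_\lambda(\beta)=\mathcal D_\lambda(\pi)$, then $Q_\lambda(\beta)=Y_\lambda(\pi)$, $\Delta_\lambda(\beta)=\Psi_\lambda(\pi)$, $\beta\in UGC$, and $\pi$ is $\lambda$-312-avoiding. (iv) The collection of the sets $\mathcal S_\lambda(\varphi)$, $\varphi\in UF$, is the same as the collection of the sets $\mathcal D_\lambda(\pi)$, $\pi$ a $\lambda$-312-avoiding $\lambda$-permutation. For each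 $\gamma\in UG$, $\Phi_\lambda(\gamma)$ is a $\lambda$-floor flag, $\Pi_\lambda(\gamma)$ is a $\lambda$-312-avoiding $\lambda$-permutation, and $\mathcal S_\lambda(\Phi_\lambda(\gamma))=\mathcal D_\lambda(\Pi_\lambda(\gamma))$; moreover $\gamma\mapsto\mathcal S_\lambda(\Phi_\lambda(\gamma))$ and $\gamma\mapsto\mathcal D_\lambda(\Pi_\lambda(\gamma))$ are bijections from $UG$ onto this common collection. -/

import Mathlib

namespace DemazureRowBound

/-! Tuples are functions on `ℕ` whose meaningful indices and values are `1, …, n`; they vanish at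
every other index, so that equality of functions is equality of tuples. -/

/-- `[1, n]`-valued tuples with indices `1, …, n`. -/
def Tuples (n : ℕ) : Set (ℕ → ℕ) :=
  {ν | (∀ i ∈ Finset.Icc 1 n, ν i ∈ Finset.Icc 1 n) ∧ ∀ i, i ∉ Finset.Icc 1 n → ν i = 0}

/-- Upper tuples. -/
def Upper (n : ℕ) : Set (ℕ → ℕ) :=
  {υ | υ ∈ Tuples n ∧ ∀ i ∈ Finset.Icc 1 n, i ≤ υ i}

/-- Upper flags. -/
def UpperFlag (n : ℕ) : Set (ℕ → ℕ) :=
  {φ | φ ∈ Upper n ∧ MonotoneOn φ (Set.Icc 1 n)}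

/-! ### Carrels
For `R ⊆ [n-1]` the indices `1, …, n` are cut after each element of `R`: if
`0 = q₀ < q₁ < … < q_r < q_{r+1} = n` with `R = {q₁, …, q_r}`, the carrels are `(q_{h-1}, q_h]`. -/

/-- The right end `q_h` of the carrel `(q_{h-1}, q_h]` containing `i`. -/
noncomputable def carrelEnd (n : ℕ) (R : Finset ℕ) (i : ℕ) : ℕ :=
  sInf {q | (q ∈ R ∨ q = n) ∧ i ≤ q}

/-- The left divider `q_{h-1}` of the carrel `(q_{h-1}, q_h]` containing `i`. -/
def carrelStart (R : Finset ℕ) (i : ℕ) : ℕ :=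
  ((insert 0 R).filter (fun q => q < i)).sup id

/-- `ν` strictly increases on every carrel. -/
def CarrelIncreasing (n : ℕ) (R : Finset ℕ) (ν : ℕ → ℕ) : Prop :=
  ∀ i ∈ Finset.Icc 1 n, ∀ j ∈ Finset.Icc 1 n,
    carrelEnd n R i = carrelEnd n R j → i < j → ν i < ν j

/-- `R`-increasing upper tuples. -/
def UpperIncreasing (n : ℕ) (R : Finset ℕ) : Set (ℕ → ℕ) :=
  {α | α ∈ Upper n ∧ CarrelIncreasing n R α}

/-- `R`-permutations. -/
def RPerm (n : ℕ) (R : Finset ℕ) : Set (ℕ → ℕ) :=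
  {π | π ∈ Tuples n ∧ Set.InjOn π (Set.Icc 1 n) ∧ CarrelIncreasing n R π}

/-- There are `h` and indices `1 ≤ a ≤ q_h < b ≤ q_{h+1} < c ≤ n` with
`π_a > π_b < π_c` and `π_a > π_c`; here `q = q_h` and `q_{h+1} = carrelEnd n R (q + 1)`. -/
def Contains312 (n : ℕ) (R : Finset ℕ) (π : ℕ → ℕ) : Prop :=
  ∃ q ∈ R, ∃ a b c : ℕ, 1 ≤ a ∧ a ≤ q ∧ q < b ∧ b ≤ carrelEnd n R (q + 1) ∧
    carrelEnd n R (q + 1) < c ∧ c ≤ n ∧ π b < π a ∧ π b < π c ∧ π c < π a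

/-- `R`-312-avoiding `R`-permutations. -/
def RPerm312 (n : ℕ) (R : Finset ℕ) : Set (ℕ → ℕ) :=
  {π | π ∈ RPerm n R ∧ ¬ Contains312 n R π}

/-- Gapless `R`-tuples. -/
def Gapless (n : ℕ) (R : Finset ℕ) : Set (ℕ → ℕ) :=
  {γ | γ ∈ UpperIncreasing n R ∧ ∀ q ∈ R, γ (q + 1) < γ q →
    q + (γ q - γ (q + 1) + 1) ≤ carrelEnd n R (q + 1) ∧
    ∀ t ∈ Finset.Icc 1 (γ q - γ (q + 1) + 1), γ (q + t) = γ q - (γ q - γ (q + 1) + 1) + t}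

/-- The `d`-th largest element of `Q`, for `1 ≤ d ≤ |Q|`. -/
def rank (d : ℕ) (Q : Finset ℕ) : ℕ :=
  (Q.filter (fun x => d ≤ (Q.filter (fun y => x ≤ y)).card)).sup id

/-- The rank tuple `Ψ_R(π)`: on the carrel `(q_{h-1}, q_h]`, its entry at `i` is the
`(q_h - i + 1)`-th largest element of `{π_1, …, π_{q_h}}`. -/
noncomputable def rankTuple (n : ℕ) (R : Finset ℕ) (π : ℕ → ℕ) : ℕ → ℕ := fun i =>
  if i ∈ Finset.Icc 1 n then
    rank (carrelEnd n R i - i + 1) ((Finset.Icc 1 (carrelEnd n R i)).image π)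
  else 0

/-- The number `s` of entries that `permOf` modifies at the start of the carrel following the
divider `q`. -/
def overlap (R : Finset ℕ) (γ : ℕ → ℕ) (q : ℕ) : ℕ :=
  if q ∈ R ∧ γ (q + 1) ≤ γ q then γ q - γ (q + 1) + 1 else 0

/-- The first `k` entries of `Π_R(γ)`, computed from left to right. With `q` the divider to the left
of the index `k + 1` and `s = overlap R γ q`, the entry at `k + 1` is the `(q + s - (k+1) + 1)`-th
largest element of `[γ_q] \ {π_1, …, π_q}` if `k + 1 ≤ q + s`, and `γ_{k+1}` otherwise. -/
def permOfAux (R : Finset ℕ) (γ : ℕ → ℕ) : ℕ → (ℕ → ℕ)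
  | 0 => fun _ => 0
  | k + 1 =>
    Function.update (permOfAux R γ k) (k + 1)
      (if k + 1 ≤ carrelStart R (k + 1) + overlap R γ (carrelStart R (k + 1)) then
        rank (carrelStart R (k + 1) + overlap R γ (carrelStart R (k + 1)) - (k + 1) + 1)
          (Finset.Icc 1 (γ (carrelStart R (k + 1))) \
            (Finset.Icc 1 (carrelStart R (k + 1))).image (permOfAux R γ k))
      else γ (k + 1))

/-- The map `Π_R`. -/
def permOf (n : ℕ) (R : Finset ℕ) (γ : ℕ → ℕ) : ℕ → ℕ := permOfAux R γ n

/-- Critical indices of `υ`: the right end of each carrel is critical, and if `y` is critical, so is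
the largest `x < y` in the same carrel (if there is one) with `υ_y - υ_x > y - x`. -/
inductive IsCritical (n : ℕ) (R : Finset ℕ) (υ : ℕ → ℕ) : ℕ → Prop
  | last (x : ℕ) (hx : x ∈ R ∨ x = n) : IsCritical n R υ x
  | step (x y : ℕ) (hy : IsCritical n R υ y) (hstart : carrelStart R y < x) (hxy : x < y)
      (hgap : υ x + (y - x) < υ y)
      (hmax : ∀ z, x < z → z < y → ¬ υ z + (y - z) < υ y) : IsCritical n R υ x

/-- The smallest critical index `x ≥ i`. -/
noncomputable def nextCritical (n : ℕ) (R : Finset ℕ) (υ : ℕ → ℕ) (i : ℕ) : ℕ :=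
  sInf {x | IsCritical n R υ x ∧ i ≤ x}

/-- The `R`-core `Δ_R(υ)`: a staircase descends to the left from each critical pair. -/
noncomputable def core (n : ℕ) (R : Finset ℕ) (υ : ℕ → ℕ) : ℕ → ℕ := fun i =>
  if i ∈ Finset.Icc 1 n then υ (nextCritical n R υ i) - (nextCritical n R υ i - i) else 0

/-- Gapless core `R`-tuples. -/
def GaplessCore (n : ℕ) (R : Finset ℕ) : Set (ℕ → ℕ) :=
  {η | η ∈ Upper n ∧ core n R η ∈ Gapless n R}

/-- `R`-floor flags: upper flags in which every plateau of length at least two begins at an element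
of `R`. -/
def FloorFlag (n : ℕ) (R : Finset ℕ) : Set (ℕ → ℕ) :=
  {τ | τ ∈ UpperFlag n ∧ ∀ i, 1 ≤ i → i < n → τ i = τ (i + 1) →
    (1 < i → τ (i - 1) ≠ τ i) → i ∈ R}

open Classical in
/-- The `R`-floor map `Φ_R`. Let `x` be the smallest critical index `≥ i`. If `i < x`, and `x` is
the leftmost critical index of a carrel `(q, q']` with `q ∈ R`, the entry at `i` is
`max (γ_q, γ_x - (x - i))`; otherwise it is `γ_x - (x - i)`. -/
noncomputable def floorMap (n : ℕ) (R : Finset ℕ) (γ : ℕ → ℕ) : ℕ → ℕ := fun i =>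
  if i ∈ Finset.Icc 1 n then
    if i < nextCritical n R γ i ∧ carrelStart R i ∈ R ∧
        ∀ z, carrelStart R i < z → z < nextCritical n R γ i → ¬ IsCritical n R γ z then
      max (γ (carrelStart R i)) (γ (nextCritical n R γ i) - (nextCritical n R γ i - i))
    else γ (nextCritical n R γ i) - (nextCritical n R γ i - i)
  else 0

/-! ### Shapes and tableaux -/

/-- Partitions `lam_1 ≥ … ≥ lam_n ≥ 0`. -/
def Partitions (n : ℕ) : Set (ℕ → ℕ) :=
  {lam | AntitoneOn lam (Set.Icc 1 n) ∧ ∀ i, i ∉ Finset.Icc 1 n → lam i = 0}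

/-- The length `ζ_j` of column `j` of the shape; the latent column `j = 0` has length `n`. -/
def colLen (n : ℕ) (lam : ℕ → ℕ) (j : ℕ) : ℕ :=
  ((Finset.Icc 1 n).filter (fun i => j ≤ lam i)).card

/-- The set `R_lam ⊆ [n-1]` of column lengths smaller than `n`. -/
def shapeR (n : ℕ) (lam : ℕ → ℕ) : Finset ℕ :=
  ((Finset.Icc 1 (lam 1)).image (colLen n lam)).filter (fun q => q ≠ n)

/-- `(j, i)` (column `j`, row `i`) is a box of the shape. -/
def IsBox (n : ℕ) (lam : ℕ → ℕ) (j i : ℕ) : Prop :=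
  1 ≤ j ∧ j ≤ lam 1 ∧ 1 ≤ i ∧ i ≤ colLen n lam j

/-- Semistandard tableaux `T` of shape `lam` with values in `[n]`; `T j i` is the value in column `j`
and row `i`, and is `0` outside the shape. On tableaux of one shape the pointwise order of functions
is the entrywise order. -/
def Tableaux (n : ℕ) (lam : ℕ → ℕ) : Set (ℕ → ℕ → ℕ) :=
  {T | (∀ j i, IsBox n lam j i → T j i ∈ Finset.Icc 1 n) ∧
    (∀ j i, ¬ IsBox n lam j i → T j i = 0) ∧
    (∀ j i i', IsBox n lam j i → IsBox n lam j i' → i < i' → T j i < T j i') ∧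
    (∀ j j' i, IsBox n lam j i → IsBox n lam j' i → j ≤ j' → T j i ≤ T j' i)}

open Classical in
/-- The key `Y_lam(π)`: a column of length `q` contains the elements of `{π_1, …, π_q}` in
increasing order, so that row `i` holds the `(q + 1 - i)`-th largest of them. -/
noncomputable def key (n : ℕ) (lam : ℕ → ℕ) (π : ℕ → ℕ) : ℕ → ℕ → ℕ := fun j i =>
  if IsBox n lam j i then
    rank (colLen n lam j + 1 - i) ((Finset.Icc 1 (colLen n lam j)).image π)
  else 0

/-! ### Scanning
Let `c l` be the number of unmarked boxes (the top ones) in column `l`. The earliest weakly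
increasing subsequence of the bottom unmarked values of the columns `j, j+1, …` is found by reading
the columns from left to right and selecting each value that is at least the last selected one. -/

/-- The last value selected (`0` if none) among columns `j, …, j + k - 1`. -/
def scanLast (T : ℕ → ℕ → ℕ) (c : ℕ → ℕ) (j : ℕ) : ℕ → ℕ
  | 0 => 0
  | k + 1 =>
    if 0 < c (j + k) ∧ scanLast T c j k ≤ T (j + k) (c (j + k)) then T (j + k) (c (j + k))
    else scanLast T c j k

/-- The column heights after the boxes of the scanning path starting in column `j` are marked. -/
def scanRemove (T : ℕ → ℕ → ℕ) (j : ℕ) (c : ℕ → ℕ) : ℕ → ℕ := fun l =>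
  if j ≤ l ∧ 0 < c l ∧ scanLast T c j (l - j) ≤ T l (c l) then c l - 1 else c l

open Classical in
/-- The scanning tableau `S(T)`: column `j` is filled from bottom to top with the final values of the
successive scanning paths in columns `j, …, lam_1`, so row `i` is reached after `ζ_j - i` paths have
been marked. -/
noncomputable def scan (n : ℕ) (lam : ℕ → ℕ) (T : ℕ → ℕ → ℕ) : ℕ → ℕ → ℕ := fun j i =>
  if IsBox n lam j i then
    scanLast T ((scanRemove T j)^[colLen n lam j - i] (colLen n lam)) j (lam 1 + 1 - j)
  else 0

/-- The Demazure set `D_lam(π)`. -/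
def DemazureSet (n : ℕ) (lam : ℕ → ℕ) (π : ℕ → ℕ) : Set (ℕ → ℕ → ℕ) :=
  {T | T ∈ Tableaux n lam ∧ scan n lam T ≤ key n lam π}

/-- The row bound set `S_lam(β)`. The condition `i ≤ β_i` comes from the latent column `0`, whose
value in row `i` is `i`; it holds for every upper `β`. -/
def RowBoundSet (n : ℕ) (lam : ℕ → ℕ) (β : ℕ → ℕ) : Set (ℕ → ℕ → ℕ) :=
  {T | T ∈ Tableaux n lam ∧ (∀ i ∈ Finset.Icc 1 n, i ≤ β i) ∧
    ∀ j i, IsBox n lam j i → T j i ≤ β i}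

/-- `Q` is the row bound max tableau `Q_lam(β)`: the least upper bound of `S_lam(β)` in the poset of
tableaux of shape `lam`. -/
def IsRowBoundMax (n : ℕ) (lam : ℕ → ℕ) (β : ℕ → ℕ) (Q : ℕ → ℕ → ℕ) : Prop :=
  IsLeast (Tableaux n lam ∩ upperBounds (RowBoundSet n lam β)) Q

end DemazureRowBound

open DemazureRowBound

namespace DemazureRowBound

variable {n : ℕ} {R : Finset ℕ} {lam : ℕ → ℕ}

/-! ### Carrels -/

/-- The right ends of carrels. -/
def IsDivider (n : ℕ) (R : Finset ℕ) (q : ℕ) : Prop := q ∈ R ∨ q = n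

theorem carrelEnd_spec {i : ℕ} (hi : i ≤ n) :
    IsDivider n R (carrelEnd n R i) ∧ i ≤ carrelEnd n R i :=
  Nat.sInf_mem (s := {q | (q ∈ R ∨ q = n) ∧ i ≤ q}) ⟨n, Or.inr rfl, hi⟩

theorem carrelEnd_le {i q : ℕ} (hq : IsDivider n R q) (hi : i ≤ q) : carrelEnd n R i ≤ q :=
  Nat.sInf_le ⟨hq, hi⟩

theorem carrelEnd_le_top {i : ℕ} (hi : i ≤ n) : carrelEnd n R i ≤ n :=
  carrelEnd_le (Or.inr rfl) hi

theorem carrelEnd_of_isDivider {q : ℕ} (hR : ∀ q ∈ R, 1 ≤ q ∧ q < n) (hq : IsDivider n R q) :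
    carrelEnd n R q = q := by
  have hqn : q ≤ n := by
    rcases hq with h | h
    · exact (hR q h).2.le
    · exact h.le
  exact le_antisymm (carrelEnd_le hq le_rfl) (carrelEnd_spec hqn).2

theorem carrelStart_lt {i : ℕ} (hi : 1 ≤ i) : carrelStart R i < i := by
  unfold carrelStart
  rw [Finset.sup_lt_iff (show (⊥ : ℕ) < i from hi)]
  intro b hb
  simpa using (Finset.mem_filter.1 hb).2

theorem le_carrelStart {i q : ℕ} (hq : q ∈ R) (hi : q < i) : q ≤ carrelStart R i := by
  unfold carrelStart
  exact Finset.le_sup (f := id) (by simp [hq, hi])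

theorem carrelStart_mem {i : ℕ} (hi : 1 ≤ i) : carrelStart R i = 0 ∨ carrelStart R i ∈ R := by
  have hne : ((insert 0 R).filter (fun q => q < i)).Nonempty :=
    ⟨0, by simp; omega⟩
  obtain ⟨x, hx, he⟩ := Finset.exists_mem_eq_sup _ hne id
  unfold carrelStart
  rw [he]
  simp only [Finset.mem_filter, Finset.mem_insert] at hx
  exact hx.1

theorem carrelStart_eq_of_carrel {i k : ℕ} (hi : 1 ≤ i) (h1 : carrelStart R i < k)
    (h2 : k ≤ carrelEnd n R i) :
    carrelStart R k = carrelStart R i := by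
  have hk : 1 ≤ k := by omega
  apply le_antisymm
  · rcases carrelStart_mem (R := R) hk with h | h
    · omega
    · by_contra hlt
      have h3 : ¬ carrelStart R k < i := fun h4 => hlt (le_carrelStart h h4)
      have h5 := carrelEnd_le (n := n) (Or.inl h) (not_lt.1 h3)
      have := carrelStart_lt (R := R) hk
      omega
  · rcases carrelStart_mem (R := R) hi with h | h
    · omega
    · exact le_carrelStart h h1

theorem carrelEnd_eq_of_carrel {i k : ℕ} (h1 : carrelStart R i < k)
    (h2 : k ≤ carrelEnd n R i) (hin : i ≤ n) :
    carrelEnd n R k = carrelEnd n R i := by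
  have hkn : k ≤ n := h2.trans (carrelEnd_le_top hin)
  apply le_antisymm
  · exact carrelEnd_le (carrelEnd_spec hin).1 h2
  · have h3 := carrelEnd_spec (R := R) hkn
    rcases h3.1 with h | h
    · by_contra hlt
      have h4 : ¬ i ≤ carrelEnd n R k := fun h5 => hlt (carrelEnd_le h3.1 h5)
      have := le_carrelStart h (not_le.1 h4)
      omega
    · rw [h]
      exact carrelEnd_le_top hin

theorem carrelStart_succ {q : ℕ} (hq : q ∈ R) : carrelStart R (q + 1) = q :=
  le_antisymm (Nat.lt_succ_iff.1 (carrelStart_lt (by omega))) (le_carrelStart hq (by omega))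

/-- Induction along the carrels. -/
theorem isDivider_induction {P : ℕ → Prop} (hR : ∀ q ∈ R, 1 ≤ q ∧ q < n) (hn : 1 ≤ n)
    (h0 : P 0)
    (hstep : ∀ q q', (q = 0 ∨ q ∈ R) → q < q' → q' = carrelEnd n R (q + 1) →
      carrelStart R q' = q → IsDivider n R q' → q' ≤ n → P q → P q')
    {q : ℕ} (hq : IsDivider n R q) : P q := by
  induction q using Nat.strong_induction_on with
  | _ q' ih =>
    have h1 : 1 ≤ q' := by
      rcases hq with h | h
      · exact (hR _ h).1
      · omega
    have hqn : q' ≤ n := by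
      rcases hq with h | h
      · exact (hR _ h).2.le
      · omega
    have hlt := carrelStart_lt (R := R) h1
    have hend : q' = carrelEnd n R (carrelStart R q' + 1) := by
      rw [carrelEnd_eq_of_carrel (i := q') (by omega) _ hqn, carrelEnd_of_isDivider hR hq]
      rw [carrelEnd_of_isDivider hR hq]
      omega
    refine hstep (carrelStart R q') q' (carrelStart_mem h1) hlt hend rfl hq hqn ?_
    rcases carrelStart_mem (R := R) h1 with h | h
    · rw [h]; exact h0
    · exact ih _ hlt (Or.inl h)

/-! ### Largest columns -/

/-- The largest value of row `i` in a column of length `q` whose rows are bounded by `β`. -/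
noncomputable def colMax (β : ℕ → ℕ) (q i : ℕ) : ℕ :=
  sInf ((fun k => β k - (k - i)) '' Set.Icc i q)

theorem le_colMax_iff {β : ℕ → ℕ} {q i v : ℕ} (hi : 1 ≤ i) (hiq : i ≤ q)
    (hβ : ∀ k, 1 ≤ k → k ≤ q → k ≤ β k) :
    v ≤ colMax β q i ↔ ∀ k, i ≤ k → k ≤ q → v + (k - i) ≤ β k := by
  unfold colMax
  constructor
  · intro h k h1 h2
    have h3 : sInf ((fun k => β k - (k - i)) '' Set.Icc i q) ≤ β k - (k - i) :=
      Nat.sInf_le ⟨k, ⟨h1, h2⟩, rfl⟩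
    have := hβ k (by omega) h2
    omega
  · intro h
    obtain ⟨k, ⟨h1, h2⟩, h3⟩ := Nat.sInf_mem
      (s := (fun k => β k - (k - i)) '' Set.Icc i q) ⟨_, i, ⟨le_rfl, hiq⟩, rfl⟩
    rw [← h3]
    have := h k h1 h2
    simp only
    omega

theorem colMax_add_le {β : ℕ → ℕ} {q i k : ℕ} (hi : 1 ≤ i)
    (hβ : ∀ k, 1 ≤ k → k ≤ q → k ≤ β k) (hik : i ≤ k) (hkq : k ≤ q) :
    colMax β q i + (k - i) ≤ β k :=
  (le_colMax_iff hi (hik.trans hkq) hβ).1 le_rfl k hik hkq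

theorem colMax_self {β : ℕ → ℕ} {q : ℕ} : colMax β q q = β q := by
  simp [colMax]

theorem exists_colMax_eq {β : ℕ → ℕ} {q i : ℕ} (hi : 1 ≤ i) (hiq : i ≤ q)
    (hβ : ∀ k, 1 ≤ k → k ≤ q → k ≤ β k) :
    ∃ k, i ≤ k ∧ k ≤ q ∧ colMax β q i + (k - i) = β k := by
  obtain ⟨k, ⟨h1, h2⟩, h3⟩ := Nat.sInf_mem
      (s := (fun k => β k - (k - i)) '' Set.Icc i q) ⟨_, i, ⟨le_rfl, hiq⟩, rfl⟩
  have := hβ k (by omega) h2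
  refine ⟨k, h1, h2, ?_⟩
  unfold colMax
  rw [← h3]
  simp only
  omega

theorem colMax_add_le_colMax {β : ℕ → ℕ} {q i k : ℕ} (hi : 1 ≤ i)
    (hβ : ∀ k, 1 ≤ k → k ≤ q → k ≤ β k) (hik : i ≤ k) (hkq : k ≤ q) :
    colMax β q i + (k - i) ≤ colMax β q k := by
  rw [le_colMax_iff (hi.trans hik) hkq hβ]
  intro l h1 h2
  have := colMax_add_le hi hβ (hik.trans h1) h2
  omega

theorem colMax_strictMonoOn {β : ℕ → ℕ} {q : ℕ} (hβ : ∀ k, 1 ≤ k → k ≤ q → k ≤ β k) :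
    StrictMonoOn (colMax β q) (Finset.Ioc 0 q) := by
  intro i hi k hk hik
  simp only [Finset.coe_Ioc, Set.mem_Ioc] at hi hk
  have := colMax_add_le_colMax (by omega) hβ hik.le hk.2
  omega

theorem le_colMax {β : ℕ → ℕ} {q i : ℕ} (hi : 1 ≤ i) (hiq : i ≤ q)
    (hβ : ∀ k, 1 ≤ k → k ≤ q → k ≤ β k) : i ≤ colMax β q i := by
  rw [le_colMax_iff hi hiq hβ]
  intro k h1 h2
  have := hβ k (by omega) h2
  omega

theorem colMax_anti {β : ℕ → ℕ} {q q' i : ℕ} (hi : 1 ≤ i) (hiq : i ≤ q) (hq : q ≤ q')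
    (hβ : ∀ k, 1 ≤ k → k ≤ q' → k ≤ β k) : colMax β q' i ≤ colMax β q i := by
  rw [le_colMax_iff hi hiq (fun k h1 h2 => hβ k h1 (h2.trans hq))]
  intro k h1 h2
  exact colMax_add_le hi hβ h1 (h2.trans hq)

theorem colMax_eq_min {β : ℕ → ℕ} {q q' i : ℕ} (hi : 1 ≤ i) (hiq : i ≤ q) (hq : q < q')
    (hβ : ∀ k, 1 ≤ k → k ≤ q' → k ≤ β k) :
    colMax β q' i = min (colMax β q i) (colMax β q' (q + 1) - (q + 1 - i)) := by
  have hβ' : ∀ k, 1 ≤ k → k ≤ q → k ≤ β k := fun k h1 h2 => hβ k h1 (by omega)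
  apply le_antisymm
  · apply le_min (colMax_anti hi hiq hq.le hβ)
    have := colMax_add_le_colMax (k := q + 1) hi hβ (by omega) (by omega)
    omega
  · rw [le_colMax_iff hi (by omega) hβ]
    intro k h1 h2
    by_cases h3 : k ≤ q
    · have := colMax_add_le hi hβ' h1 h3
      omega
    · have := colMax_add_le (q := q') (i := q + 1) (by omega) hβ (by omega : q + 1 ≤ k) h2
      have := le_colMax (q := q') (i := q + 1) (by omega) (by omega) hβ
      omega

theorem colMax_le {β : ℕ → ℕ} {q i : ℕ} (hi : 1 ≤ i) (hiq : i ≤ q)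
    (hβ : ∀ k, 1 ≤ k → k ≤ q → k ≤ β k) : colMax β q i ≤ β i := by
  simpa using colMax_add_le hi hβ le_rfl hiq

theorem colMax_le_self {β : ℕ → ℕ} {q i : ℕ} (hi : 1 ≤ i) (hiq : i ≤ q)
    (hβ : ∀ k, 1 ≤ k → k ≤ q → k ≤ β k) : colMax β q i ≤ β q := by
  have := colMax_add_le hi hβ hiq le_rfl
  omega

/-! ### Upper tuples and cores -/

theorem upper_le {υ : ℕ → ℕ} (h : υ ∈ Upper n) {q : ℕ} (hq : q ≤ n) :
    ∀ k, 1 ≤ k → k ≤ q → k ≤ υ k :=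
  fun k h1 h2 => h.2 k (Finset.mem_Icc.2 ⟨h1, h2.trans hq⟩)

theorem upper_le_top {υ : ℕ → ℕ} (h : υ ∈ Upper n) {k : ℕ} (h1 : 1 ≤ k) (h2 : k ≤ n) : υ k ≤ n :=
  (Finset.mem_Icc.1 (h.1.1 k (Finset.mem_Icc.2 ⟨h1, h2⟩))).2

theorem upper_apply_zero {υ : ℕ → ℕ} (h : υ ∈ Upper n) : υ 0 = 0 := h.1.2 0 (by simp)

theorem mem_upper_of {υ : ℕ → ℕ} (h1 : ∀ i, 1 ≤ i → i ≤ n → i ≤ υ i ∧ υ i ≤ n)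
    (h2 : ∀ i, i ∉ Finset.Icc 1 n → υ i = 0) : υ ∈ Upper n := by
  refine ⟨⟨fun i hi => ?_, h2⟩, fun i hi => ?_⟩ <;> rw [Finset.mem_Icc] at hi
  · have := h1 i hi.1 hi.2
    rw [Finset.mem_Icc]
    omega
  · exact (h1 i hi.1 hi.2).1

theorem colMax_top {β : ℕ → ℕ} (hβ : β ∈ Upper n) {i : ℕ} (hi : 1 ≤ i) (hin : i ≤ n) :
    colMax β n i = i := by
  apply le_antisymm
  · have h1 := colMax_add_le hi (upper_le hβ le_rfl) hin le_rfl
    have h2 := upper_le_top hβ (hi.trans hin) le_rfl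
    omega
  · exact le_colMax hi hin (upper_le hβ le_rfl)

theorem IsCritical.le_of_carrel {υ : ℕ → ℕ} (hR : ∀ q ∈ R, 1 ≤ q ∧ q < n) {y : ℕ}
    (hy : IsCritical n R υ y) : y ≤ n ∧ (1 ≤ n → 1 ≤ y) ∧
      ∀ z, y ≤ z → z ≤ carrelEnd n R y → υ y + (z - y) ≤ υ z := by
  induction hy with
  | last x hx =>
    refine ⟨?_, ?_, ?_⟩
    · rcases hx with h | h
      · exact (hR _ h).2.le
      · exact h.le
    · rcases hx with h | h
      · exact fun _ => (hR _ h).1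
      · exact fun _ => by omega
    · intro z h1 h2
      rw [carrelEnd_of_isDivider hR hx] at h2
      obtain rfl : z = x := le_antisymm h2 h1
      simp
  | step x y hy hstart hxy hgap hmax ih =>
    obtain ⟨ih1, ih2, ih3⟩ := ih
    have hn : 1 ≤ n := by omega
    refine ⟨by omega, fun _ => by omega, ?_⟩
    intro z h1 h2
    rw [carrelEnd_eq_of_carrel hstart
      (hxy.le.trans (carrelEnd_spec ih1).2) ih1] at h2
    rcases lt_or_ge z y with h3 | h3
    · rcases eq_or_lt_of_le h1 with h4 | h4
      · subst h4; simp
      · have := hmax z h4 h3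
        omega
    · have := ih3 z h3 h2
      omega

theorem nextCritical_spec {υ : ℕ → ℕ} {i : ℕ} (hin : i ≤ n) :
    IsCritical n R υ (nextCritical n R υ i) ∧ i ≤ nextCritical n R υ i ∧
      nextCritical n R υ i ≤ carrelEnd n R i := by
  have h1 := carrelEnd_spec (R := R) hin
  have h2 : carrelEnd n R i ∈ {x | IsCritical n R υ x ∧ i ≤ x} := ⟨.last _ h1.1, h1.2⟩
  have h3 := Nat.sInf_mem (s := {x | IsCritical n R υ x ∧ i ≤ x}) ⟨_, h2⟩
  exact ⟨h3.1, h3.2, Nat.sInf_le h2⟩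

theorem nextCritical_le_of {υ : ℕ → ℕ} {i k : ℕ}
    (hi : 1 ≤ i) (hin : i ≤ n) (hik : i ≤ k) (hk : k < nextCritical n R υ i) :
    υ (nextCritical n R υ i) ≤ υ k + (nextCritical n R υ i - k) := by
  obtain ⟨hc, h1, h2⟩ := nextCritical_spec (R := R) (υ := υ) hin
  by_contra hlt
  let P : ℕ → Prop := fun z => i ≤ z ∧ z < nextCritical n R υ i ∧
    υ z + (nextCritical n R υ i - z) < υ (nextCritical n R υ i)
  classical
  have hP : P k := ⟨hik, hk, not_le.1 hlt⟩
  have hg := Nat.findGreatest_spec (P := P) hk.le hP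
  set g := Nat.findGreatest P (nextCritical n R υ i) with hgdef
  have hs : carrelStart R (nextCritical n R υ i) < g := by
    have := carrelStart_lt (R := R) hi
    rw [carrelStart_eq_of_carrel hi (by omega) h2]
    have := hg.1
    omega
  have hcrit : IsCritical n R υ g := .step g _ hc hs hg.2.1 hg.2.2 (by
    intro z hz1 hz2 hz3
    have := Nat.le_findGreatest (P := P) hz2.le ⟨hg.1.trans hz1.le, hz2, hz3⟩
    omega)
  have : nextCritical n R υ i ≤ g := Nat.sInf_le ⟨hcrit, hg.1⟩
  have := hg.2.1
  omega

theorem core_eq_colMax {υ : ℕ → ℕ} (hR : ∀ q ∈ R, 1 ≤ q ∧ q < n) (hυ : υ ∈ Upper n) {i : ℕ}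
    (hi : 1 ≤ i) (hin : i ≤ n) : core n R υ i = colMax υ (carrelEnd n R i) i := by
  obtain ⟨hc, h1, h2⟩ := nextCritical_spec (R := R) (υ := υ) hin
  have hen := carrelEnd_le_top (R := R) hin
  have hup := upper_le hυ hen
  have hlt := carrelStart_lt (R := R) hi
  unfold core
  rw [if_pos (Finset.mem_Icc.2 ⟨hi, hin⟩)]
  have hx := hup _ (hi.trans h1) h2
  apply le_antisymm
  · rw [le_colMax_iff hi (carrelEnd_spec hin).2 hup]
    intro k hk1 hk2
    rcases lt_or_ge k (nextCritical n R υ i) with h3 | h3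
    · have := nextCritical_le_of hi hin hk1 h3
      omega
    · have := (hc.le_of_carrel hR).2.2 k h3
        (by rwa [carrelEnd_eq_of_carrel (by omega) h2 hin])
      omega
  · have := colMax_add_le hi hup h1 h2
    omega

theorem core_mem_upperIncreasing {υ : ℕ → ℕ} (hR : ∀ q ∈ R, 1 ≤ q ∧ q < n) (hυ : υ ∈ Upper n) :
    core n R υ ∈ UpperIncreasing n R := by
  refine ⟨mem_upper_of (fun i hi hin => ?_) (fun i hi => by simp only [core]; rw [if_neg hi]), ?_⟩
  · rw [core_eq_colMax hR hυ hi hin]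
    have hup := upper_le hυ (carrelEnd_le_top (R := R) hin)
    exact ⟨le_colMax hi (carrelEnd_spec hin).2 hup,
      (colMax_le hi (carrelEnd_spec hin).2 hup).trans (upper_le_top hυ hi hin)⟩
  · intro i hi j hj he hij
    rw [Finset.mem_Icc] at hi hj
    rw [core_eq_colMax hR hυ hi.1 hi.2, core_eq_colMax hR hυ hj.1 hj.2, he]
    have := colMax_add_le_colMax hi.1 (upper_le hυ (carrelEnd_le_top (R := R) hj.2)) hij.le
      (carrelEnd_spec hj.2).2
    omega

/-- Largest columns whose length is a divider depend only on the core. -/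
theorem colMax_core {υ : ℕ → ℕ} (hR : ∀ q ∈ R, 1 ≤ q ∧ q < n) (hυ : υ ∈ Upper n) {q i : ℕ}
    (hq : IsDivider n R q) (hqn : q ≤ n) (hi : 1 ≤ i) (hiq : i ≤ q) :
    colMax (core n R υ) q i = colMax υ q i := by
  have hc := (core_mem_upperIncreasing hR hυ).1
  apply le_antisymm
  · rw [le_colMax_iff hi hiq (upper_le hυ hqn)]
    intro k h1 h2
    have h3 := colMax_add_le hi (upper_le hc hqn) h1 h2
    rw [core_eq_colMax hR hυ (by omega) (by omega)] at h3
    have := colMax_le (by omega) (carrelEnd_spec (h2.trans hqn)).2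
      (upper_le hυ (carrelEnd_le_top (R := R) (h2.trans hqn)))
    omega
  · rw [le_colMax_iff hi hiq (upper_le hc hqn)]
    intro k h1 h2
    rw [core_eq_colMax hR hυ (by omega) (by omega)]
    have h3 := colMax_add_le_colMax hi (upper_le hυ hqn) h1 h2
    have := colMax_anti (by omega) (carrelEnd_spec (h2.trans hqn)).2 (carrelEnd_le hq h2)
      (upper_le hυ hqn)
    omega

theorem upperIncreasing_add_le {γ : ℕ → ℕ}
    (hγ : γ ∈ UpperIncreasing n R) {i k : ℕ} (hi : 1 ≤ i) (hin : i ≤ n) (hik : i ≤ k)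
    (hk : k ≤ carrelEnd n R i) : γ i + (k - i) ≤ γ k := by
  induction k, hik using Nat.le_induction with
  | base => simp
  | succ k hik ih =>
    have hen := carrelEnd_le_top (R := R) hin
    have hlt := carrelStart_lt (R := R) hi
    have h1 := hγ.2 k (Finset.mem_Icc.2 ⟨by omega, by omega⟩) (k + 1)
      (Finset.mem_Icc.2 ⟨by omega, by omega⟩)
      (by rw [carrelEnd_eq_of_carrel (by omega) (by omega : k ≤ _) hin,
            carrelEnd_eq_of_carrel (by omega) hk hin]) (by omega)
    have := ih (by omega)
    omega

theorem core_eq_self {γ : ℕ → ℕ} (hR : ∀ q ∈ R, 1 ≤ q ∧ q < n) (hγ : γ ∈ UpperIncreasing n R) :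
    core n R γ = γ := by
  funext i
  by_cases h : i ∈ Finset.Icc 1 n
  · obtain ⟨hi, hin⟩ := Finset.mem_Icc.1 h
    have hup := upper_le hγ.1 (carrelEnd_le_top (R := R) hin)
    rw [core_eq_colMax hR hγ.1 hi hin]
    apply le_antisymm (colMax_le hi (carrelEnd_spec hin).2 hup)
    rw [le_colMax_iff hi (carrelEnd_spec hin).2 hup]
    exact fun k h1 h2 => upperIncreasing_add_le hγ hi hin h1 h2
  · rw [hγ.1.1.2 i h]
    simp only [core]
    rw [if_neg h]

theorem colMax_of_carrel {γ : ℕ → ℕ} (hR : ∀ q ∈ R, 1 ≤ q ∧ q < n)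
    (hγ : γ ∈ UpperIncreasing n R) {i : ℕ} (hi : 1 ≤ i) (hin : i ≤ n) :
    colMax γ (carrelEnd n R i) i = γ i := by
  rw [← core_eq_colMax hR hγ.1 hi hin, core_eq_self hR hγ]

/-! ### Enumerations of finite sets -/

theorem strictMonoOn_add_le {f : ℕ → ℕ} {a b : ℕ} (hf : StrictMonoOn f (Finset.Ioc a b)) {i k : ℕ}
    (hi : a < i) (hik : i ≤ k) (hk : k ≤ b) : f i + (k - i) ≤ f k := by
  induction k, hik using Nat.le_induction with
  | base => simp
  | succ k hik ih =>
    have h1 := ih (by omega)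
    have h2 := hf (a := k) (b := k + 1) (by simp; omega) (by simp; omega) (by omega)
    omega

theorem strictMonoOn_consecutive {f : ℕ → ℕ} {a b : ℕ} (hf : StrictMonoOn f (Finset.Ioc a b))
    {i : ℕ} (hi : a < i) (hib : i ≤ b) {t : ℕ}
    (h : ∀ v, f i ≤ v → v ≤ f i + t → v ∈ (Finset.Ioc a b).image f) :
    i + t ≤ b ∧ f (i + t) = f i + t := by
  induction t with
  | zero => simpa using hib
  | succ t ih =>
    obtain ⟨h1, h2⟩ := ih (fun v hv1 hv2 => h v hv1 (by omega))
    obtain ⟨k, hk, hk'⟩ := Finset.mem_image.1 (h (f i + (t + 1)) (by omega) le_rfl)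
    rw [Finset.mem_Ioc] at hk
    have h3 : i + t < k := by
      by_contra h4
      have := strictMonoOn_add_le hf hk.1 (not_lt.1 h4) h1
      omega
    have h4 := strictMonoOn_add_le hf (i := i + t) (by omega) h3.le hk.2
    obtain rfl : k = i + (t + 1) := by omega
    exact ⟨hk.2, hk'⟩

theorem rank_eq {Q : Finset ℕ} {x d : ℕ} (hx : x ∈ Q)
    (hd : (Q.filter (fun y => x ≤ y)).card = d) : rank d Q = x := by
  unfold rank
  apply le_antisymm
  · rw [Finset.sup_le_iff]
    intro y hy
    rw [Finset.mem_filter] at hy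
    by_contra hlt
    simp only [id, not_le] at hlt
    have h1 : Q.filter (fun z => y ≤ z) ⊂ Q.filter (fun z => x ≤ z) := by
      rw [Finset.ssubset_iff_of_subset]
      · exact ⟨x, by simp [hx], by simp [hlt]⟩
      · intro z hz
        rw [Finset.mem_filter] at hz ⊢
        exact ⟨hz.1, by omega⟩
    have := Finset.card_lt_card h1
    omega
  · exact Finset.le_sup (f := id) (by simp [hx, hd])

theorem rank_spec {Q : Finset ℕ} {d : ℕ} (h1 : 1 ≤ d) (h2 : d ≤ Q.card) :
    rank d Q ∈ Q ∧ (Q.filter (fun y => rank d Q ≤ y)).card = d := by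
  let g : ℕ → ℕ := fun x => (Q.filter (fun y => x ≤ y)).card
  have hinj : Set.InjOn g Q := by
    have key : ∀ x ∈ Q, ∀ y, x < y → g y < g x := by
      intro x hx y hxy
      apply Finset.card_lt_card
      rw [Finset.ssubset_iff_of_subset]
      · exact ⟨x, by simp [hx], by simp [hxy]⟩
      · intro z hz
        rw [Finset.mem_filter] at hz ⊢
        exact ⟨hz.1, by omega⟩
    intro x hx y hy hxy
    rcases lt_trichotomy x y with h | h | h
    · have := key x hx y h; omega
    · exact h
    · have := key y hy x h; omega
  have himg : Q.image g = Finset.Icc 1 Q.card := by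
    apply Finset.eq_of_subset_of_card_le
    · intro z hz
      obtain ⟨x, hx, rfl⟩ := Finset.mem_image.1 hz
      rw [Finset.mem_Icc]
      exact ⟨Finset.card_pos.2 ⟨x, by simp [hx]⟩, Finset.card_le_card (Finset.filter_subset _ _)⟩
    · rw [Finset.card_image_of_injOn hinj]
      simp
  have hd : d ∈ Q.image g := by rw [himg, Finset.mem_Icc]; exact ⟨h1, h2⟩
  obtain ⟨x, hx, hxd⟩ := Finset.mem_image.1 hd
  rw [rank_eq hx hxd]
  exact ⟨hx, hxd⟩

theorem rank_lt_rank {Q : Finset ℕ} {d d' : ℕ} (h1 : 1 ≤ d) (h2 : d < d') (h3 : d' ≤ Q.card) :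
    rank d' Q < rank d Q := by
  by_contra h
  have h4 := (rank_spec h1 (h2.le.trans h3)).2
  have h5 := (rank_spec (h1.trans h2.le) h3).2
  have h6 : Q.filter (fun y => rank d' Q ≤ y) ⊆ Q.filter (fun y => rank d Q ≤ y) := by
    intro z hz
    rw [Finset.mem_filter] at hz ⊢
    exact ⟨hz.1, by omega⟩
  have := Finset.card_le_card h6
  omega

theorem rank_strictMonoOn {Q : Finset ℕ} {a b : ℕ} (h : Q.card = b - a) :
    StrictMonoOn (fun i => rank (b - i + 1) Q) (Finset.Ioc a b) := by
  intro i hi k hk hik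
  simp only [Finset.coe_Ioc, Set.mem_Ioc] at hi hk
  exact rank_lt_rank (by omega) (by omega) (by omega)

theorem image_rank {Q : Finset ℕ} {a b : ℕ} (h : Q.card = b - a) :
    (Finset.Ioc a b).image (fun i => rank (b - i + 1) Q) = Q := by
  apply Finset.eq_of_subset_of_card_le
  · intro x hx
    obtain ⟨i, hi, rfl⟩ := Finset.mem_image.1 hx
    rw [Finset.mem_Ioc] at hi
    exact (rank_spec (by omega) (by omega)).1
  · rw [Finset.card_image_of_injOn (rank_strictMonoOn h).injOn]
    simp [h]

theorem card_filter_image {f : ℕ → ℕ} {a b : ℕ} (hf : StrictMonoOn f (Finset.Ioc a b)) {i : ℕ}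
    (hi : a < i) (hib : i ≤ b) :
    (((Finset.Ioc a b).image f).filter (fun y => f i ≤ y)).card = b - i + 1 := by
  have h1 : ((Finset.Ioc a b).image f).filter (fun y => f i ≤ y) = (Finset.Icc i b).image f := by
    ext y
    simp only [Finset.mem_filter, Finset.mem_image, Finset.mem_Ioc, Finset.mem_Icc]
    constructor
    · rintro ⟨⟨k, hk, rfl⟩, hy⟩
      refine ⟨k, ⟨?_, hk.2⟩, rfl⟩
      by_contra hlt
      have := hf (a := k) (b := i) (by simpa using hk) (by simp; omega) (by omega)
      omega
    · rintro ⟨k, hk, rfl⟩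
      refine ⟨⟨k, ⟨by omega, hk.2⟩, rfl⟩, ?_⟩
      have := strictMonoOn_add_le hf hi hk.1 hk.2
      omega
  rw [h1, Finset.card_image_of_injOn]
  · simp; omega
  · apply hf.injOn.mono
    intro k hk
    simp only [Finset.coe_Ioc, Finset.coe_Icc, Set.mem_Ioc, Set.mem_Icc] at hk ⊢
    omega

theorem rank_image {f : ℕ → ℕ} {a b : ℕ} (hf : StrictMonoOn f (Finset.Ioc a b)) {i : ℕ}
    (hi : a < i) (hib : i ≤ b) : rank (b - i + 1) ((Finset.Ioc a b).image f) = f i :=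
  rank_eq (Finset.mem_image_of_mem _ (Finset.mem_Ioc.2 ⟨hi, hib⟩)) (card_filter_image hf hi hib)

theorem card_filter_le_image {f : ℕ → ℕ} {b : ℕ} (hf : StrictMonoOn f (Finset.Ioc 0 b)) {i : ℕ}
    (hi : 0 < i) (hib : i ≤ b) :
    (((Finset.Ioc 0 b).image f).filter (fun y => y ≤ f i)).card = i := by
  have h1 : ((Finset.Ioc 0 b).image f).filter (fun y => y ≤ f i) = (Finset.Icc 1 i).image f := by
    ext y
    simp only [Finset.mem_filter, Finset.mem_image, Finset.mem_Ioc, Finset.mem_Icc]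
    constructor
    · rintro ⟨⟨k, hk, rfl⟩, hy⟩
      refine ⟨k, ⟨by omega, ?_⟩, rfl⟩
      by_contra hlt
      have := hf (a := i) (b := k) (by simp; omega) (by simpa using hk) (by omega)
      omega
    · rintro ⟨k, hk, rfl⟩
      refine ⟨⟨k, ⟨by omega, by omega⟩, rfl⟩, ?_⟩
      have := strictMonoOn_add_le hf (i := k) (by omega) hk.2 hib
      omega
  rw [h1, Finset.card_image_of_injOn]
  · simp
  · apply hf.injOn.mono
    intro k hk
    simp only [Finset.coe_Ioc, Finset.coe_Icc, Set.mem_Ioc, Set.mem_Icc] at hk ⊢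
    omega

/-- If at least `i` elements of the set enumerated by `f` are at most `v`, then `f i ≤ v`. -/
theorem apply_le_of_card_le {f : ℕ → ℕ} {b : ℕ} (hf : StrictMonoOn f (Finset.Ioc 0 b)) {i v : ℕ}
    (hi : 0 < i) (hib : i ≤ b) {S : Finset ℕ} (hS : i ≤ S.card)
    (h : ∀ y ∈ S, y ∈ (Finset.Ioc 0 b).image f ∧ y ≤ v) : f i ≤ v := by
  by_contra hlt
  have h1 : S ⊂ ((Finset.Ioc 0 b).image f).filter (fun y => y ≤ f i) := by
    rw [Finset.ssubset_iff_of_subset]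
    · refine ⟨f i, ?_, fun h2 => hlt (h _ h2).2⟩
      rw [Finset.mem_filter]
      exact ⟨Finset.mem_image_of_mem _ (Finset.mem_Ioc.2 ⟨hi, hib⟩), le_rfl⟩
    · intro y hy
      rw [Finset.mem_filter]
      exact ⟨(h y hy).1, by have := (h y hy).2; omega⟩
  have := Finset.card_lt_card h1
  rw [card_filter_le_image hf hi hib] at this
  omega

/-! ### Gapless tuples -/

theorem strictMonoOn_carrel {γ : ℕ → ℕ} (hγ : γ ∈ UpperIncreasing n R) {i : ℕ} (hin : i ≤ n) :
    StrictMonoOn γ (Finset.Ioc (carrelStart R i) (carrelEnd n R i)) := by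
  intro j hj k hk hjk
  simp only [Finset.coe_Ioc, Set.mem_Ioc] at hj hk
  have hen := carrelEnd_le_top (R := R) hin
  have := upperIncreasing_add_le hγ (i := j) (k := k) (by omega) (by omega) hjk.le
    (by rw [carrelEnd_eq_of_carrel hj.1 hj.2 hin]; exact hk.2)
  omega

theorem gapless_apply_add {γ : ℕ → ℕ} (hγ : γ ∈ Gapless n R) {q v : ℕ} (hq : q ∈ R)
    (hqn : q < n) (h1 : γ (q + 1) ≤ v) (h2 : v ≤ γ q) :
    q + 1 + (v - γ (q + 1)) ≤ carrelEnd n R (q + 1) ∧ γ (q + 1 + (v - γ (q + 1))) = v := by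
  have h4 := upper_le hγ.1.1 (le_refl n) (q + 1) (by omega) (by omega)
  have h5 := (carrelEnd_spec (R := R) (n := n) (i := q + 1) (by omega)).2
  rcases eq_or_lt_of_le (h1.trans h2) with h3 | h3
  · obtain rfl : v = γ (q + 1) := by omega
    simpa using h5
  · obtain ⟨h6, h7⟩ := hγ.2 q hq h3
    have := h7 (v - γ (q + 1) + 1) (by rw [Finset.mem_Icc]; omega)
    rw [show q + 1 + (v - γ (q + 1)) = q + (v - γ (q + 1) + 1) by omega]
    omega

theorem mem_gapless_of {γ : ℕ → ℕ} (hR : ∀ q ∈ R, 1 ≤ q ∧ q < n) (hγ : γ ∈ UpperIncreasing n R)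
    (h : ∀ q ∈ R, ∀ v, γ (q + 1) ≤ v → v ≤ γ q →
      ∃ k, q < k ∧ k ≤ carrelEnd n R (q + 1) ∧ γ k = v) : γ ∈ Gapless n R := by
  refine ⟨hγ, fun q hq hlt => ?_⟩
  have hqn := (hR q hq).2
  have hmono := strictMonoOn_carrel hγ (i := q + 1) (by omega)
  rw [carrelStart_succ hq] at hmono
  have h5 := (carrelEnd_spec (R := R) (n := n) (i := q + 1) (by omega)).2
  have h4 := upper_le hγ.1 (le_refl n) (q + 1) (by omega) (by omega)
  have key : ∀ t, t ≤ γ q - γ (q + 1) →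
      q + 1 + t ≤ carrelEnd n R (q + 1) ∧ γ (q + 1 + t) = γ (q + 1) + t := by
    intro t ht
    apply strictMonoOn_consecutive hmono (by omega) h5
    intro v hv1 hv2
    obtain ⟨k, hk1, hk2, hk3⟩ := h q hq v hv1 (by omega)
    exact Finset.mem_image.2 ⟨k, Finset.mem_Ioc.2 ⟨hk1, hk2⟩, hk3⟩
  refine ⟨by have := key _ le_rfl; omega, fun t ht => ?_⟩
  rw [Finset.mem_Icc] at ht
  have := (key (t - 1) (by omega)).2
  rw [show q + 1 + (t - 1) = q + t by omega] at this
  omega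

theorem core_mem_gapless_of_upperFlag {φ : ℕ → ℕ} (hR : ∀ q ∈ R, 1 ≤ q ∧ q < n)
    (hφ : φ ∈ UpperFlag n) : core n R φ ∈ Gapless n R := by
  have hγ := core_mem_upperIncreasing hR hφ.1
  refine mem_gapless_of hR hγ fun q hq v h1 h2 => ?_
  obtain ⟨hq1, hqn⟩ := hR q hq
  have hspec := carrelEnd_spec (R := R) (n := n) (i := q + 1) (by omega)
  have hen := carrelEnd_le_top (R := R) (n := n) (i := q + 1) (by omega)
  obtain ⟨x, hx1, hx2, hx3⟩ := exists_colMax_eq (by omega) hspec.2 (upper_le hφ.1 hen)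
  rw [← core_eq_colMax hR hφ.1 (by omega) (by omega)] at hx3
  have h3 : core n R φ q ≤ φ q := by
    rw [core_eq_colMax hR hφ.1 hq1 hqn.le, carrelEnd_of_isDivider hR (Or.inl hq), colMax_self]
  have h4 : φ q ≤ φ x := hφ.2 ⟨hq1, hqn.le⟩ ⟨by omega, by omega⟩ (by omega)
  refine ⟨q + 1 + (v - core n R φ (q + 1)), by omega, by omega, ?_⟩
  apply le_antisymm
  · rw [core_eq_colMax hR hφ.1 (by omega) (by omega),
      carrelEnd_eq_of_carrel (i := q + 1) (by rw [carrelStart_succ hq]; omega) (by omega)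
      (by omega)]
    have := colMax_add_le (i := q + 1 + (v - core n R φ (q + 1))) (by omega)
      (upper_le hφ.1 hen) (by omega) hx2
    omega
  · have := upperIncreasing_add_le hγ (i := q + 1)
      (k := q + 1 + (v - core n R φ (q + 1))) (by omega) (by omega) (by omega) (by omega)
    omega

/-! ### The floor map -/

theorem gapless_carrelStart_le_of_isCritical {γ : ℕ → ℕ} (hR : ∀ q ∈ R, 1 ≤ q ∧ q < n)
    (hγ : γ ∈ Gapless n R) {z : ℕ} (hz : IsCritical n R γ z) (h1 : 1 ≤ z) :
    γ (carrelStart R z) ≤ γ z := by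
  have hzn := (hz.le_of_carrel hR).1
  have hlt := carrelStart_lt (R := R) h1
  rcases carrelStart_mem (R := R) h1 with h | hq
  · rw [h, upper_apply_zero hγ.1.1]; omega
  set q := carrelStart R z with hqdef
  by_contra hcon
  have hqn := (hR q hq).2
  have hend : carrelEnd n R (q + 1) = carrelEnd n R z :=
    carrelEnd_eq_of_carrel (by omega) (by have := (carrelEnd_spec (R := R) hzn).2; omega) hzn
  have hadd := upperIncreasing_add_le hγ.1 (i := q + 1) (k := z) (by omega) (by omega) (by omega)
    (by rw [hend]; exact (carrelEnd_spec hzn).2)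
  obtain ⟨h3, h4⟩ := gapless_apply_add hγ hq hqn (v := γ z + 1) (by omega) (by omega)
  have h5 := upperIncreasing_add_le hγ.1 (i := z) (k := q + 1 + (γ z + 1 - γ (q + 1))) h1 hzn
    (by omega) (by rw [← hend]; exact h3)
  have h6 : q + 1 + (γ z + 1 - γ (q + 1)) = z + 1 := by omega
  rw [h6] at h3 h4
  cases hz with
  | last _ hx =>
    rw [hend, carrelEnd_of_isDivider hR hx] at h3
    omega
  | step _ y hy hstart hzy hgap hmax =>
    rcases eq_or_lt_of_le (show z + 1 ≤ y from hzy) with h7 | h7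
    · subst h7; omega
    · have := hmax (z + 1) (by omega) h7
      omega

theorem floorMap_eq_max {γ : ℕ → ℕ} (hR : ∀ q ∈ R, 1 ≤ q ∧ q < n) (hγ : γ ∈ Gapless n R) {i : ℕ}
    (hi : 1 ≤ i) (hin : i ≤ n) : floorMap n R γ i = max (γ (carrelStart R i)) (γ i) := by
  have hcore : γ (nextCritical n R γ i) - (nextCritical n R γ i - i) = γ i := by
    have h := congrFun (core_eq_self hR hγ.1) i
    simp only [core] at h
    rwa [if_pos (Finset.mem_Icc.2 ⟨hi, hin⟩)] at h
  unfold floorMap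
  rw [if_pos (Finset.mem_Icc.2 ⟨hi, hin⟩), hcore]
  split_ifs with hcond
  · rfl
  · rw [max_eq_right]
    rcases carrelStart_mem (R := R) hi with h | hq
    · rw [h, upper_apply_zero hγ.1.1]; omega
    have hlt := carrelStart_lt (R := R) hi
    obtain ⟨hc, h1, h2⟩ := nextCritical_spec (R := R) (υ := γ) hin
    have hz : ∃ z, carrelStart R i < z ∧ z ≤ i ∧ IsCritical n R γ z := by
      rcases eq_or_lt_of_le h1 with h3 | h3
      · exact ⟨i, hlt, le_rfl, by rw [h3]; exact hc⟩
      · simp only [h3, hq, true_and, not_forall, not_not] at hcond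
        obtain ⟨z, hz1, hz2, hz3⟩ := hcond
        refine ⟨z, hz1, ?_, hz3⟩
        by_contra hlt
        have : nextCritical n R γ i ≤ z := Nat.sInf_le ⟨hz3, by omega⟩
        omega
    obtain ⟨z, hz1, hz2, hz3⟩ := hz
    have hzend := hz2.trans (carrelEnd_spec (R := R) hin).2
    have h3 := gapless_carrelStart_le_of_isCritical hR hγ hz3 (by omega)
    rw [carrelStart_eq_of_carrel hi hz1 hzend] at h3
    have h4 := upperIncreasing_add_le hγ.1 (i := z) (k := i) (by omega) (by omega) hz2
      (by rw [carrelEnd_eq_of_carrel hz1 hzend hin]; exact (carrelEnd_spec hin).2)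
    omega

theorem floorMap_mem_upperFlag {γ : ℕ → ℕ} (hR : ∀ q ∈ R, 1 ≤ q ∧ q < n) (hγ : γ ∈ Gapless n R) :
    floorMap n R γ ∈ UpperFlag n := by
  constructor
  · refine mem_upper_of (fun i hi hin => ?_) (fun i hi => by simp only [floorMap]; rw [if_neg hi])
    rw [floorMap_eq_max hR hγ hi hin]
    have h1 := upper_le hγ.1.1 le_rfl i hi hin
    refine ⟨h1.trans (le_max_right _ _), max_le ?_ (upper_le_top hγ.1.1 hi hin)⟩
    have := carrelStart_lt (R := R) hi
    rcases carrelStart_mem (R := R) hi with h | h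
    · rw [h, upper_apply_zero hγ.1.1]; omega
    · exact upper_le_top hγ.1.1 (hR _ h).1 (by omega)
  · have hstep : ∀ i, 1 ≤ i → i + 1 ≤ n → floorMap n R γ i ≤ floorMap n R γ (i + 1) := by
      intro i hi hin
      rw [floorMap_eq_max hR hγ hi (by omega), floorMap_eq_max hR hγ (by omega) hin]
      by_cases hiR : i ∈ R
      · rw [carrelStart_succ hiR]
        have := gapless_carrelStart_le_of_isCritical hR hγ (.last i (Or.inl hiR)) hi
        exact le_trans (max_le this le_rfl) (le_max_left _ _)
      · have hspec := carrelEnd_spec (R := R) (n := n) (i := i) (by omega)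
        have hne : carrelEnd n R i ≠ i := by
          intro h
          rw [h] at hspec
          rcases hspec.1 with h1 | h1
          · exact hiR h1
          · omega
        have hlt := carrelStart_lt (R := R) hi
        rw [carrelStart_eq_of_carrel (n := n) (i := i) hi (k := i + 1) (by omega) (by omega)]
        have := upperIncreasing_add_le hγ.1 (i := i) (k := i + 1) hi (by omega) (by omega)
          (by omega)
        exact max_le_max le_rfl (by omega)
    intro i hi k hk hik
    induction k, hik using Nat.le_induction with
    | base => exact le_rfl
    | succ k hik ih =>
      exact (ih ⟨hi.1.trans hik, by have := hk.2; omega⟩).trans (hstep k (hi.1.trans hik) hk.2)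

theorem floorMap_mem_floorFlag {γ : ℕ → ℕ} (hR : ∀ q ∈ R, 1 ≤ q ∧ q < n) (hγ : γ ∈ Gapless n R) :
    floorMap n R γ ∈ FloorFlag n R := by
  refine ⟨floorMap_mem_upperFlag hR hγ, fun i hi hin heq hne => ?_⟩
  by_contra hiR
  have hin' : i + 1 ≤ n := hin
  have hspec := carrelEnd_spec (R := R) (n := n) (i := i) hin.le
  have hend : carrelEnd n R i ≠ i := by
    intro h
    rw [h] at hspec
    rcases hspec.1 with h1 | h1
    · exact hiR h1
    · omega
  have hlt := carrelStart_lt (R := R) hi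
  rw [floorMap_eq_max hR hγ hi hin.le, floorMap_eq_max hR hγ (by omega) hin',
    carrelStart_eq_of_carrel (n := n) (i := i) hi (k := i + 1) (by omega) (by omega)] at heq
  have h1 := upperIncreasing_add_le hγ.1 (i := i) (k := i + 1) hi (by omega) (by omega)
    (by omega)
  rcases carrelStart_mem (R := R) hi with h | h
  · rw [h, upper_apply_zero hγ.1.1] at heq
    omega
  · have h2 := (hR _ h).1
    refine hne (by omega) ?_
    rw [floorMap_eq_max hR hγ hi hin.le, floorMap_eq_max hR hγ (by omega) (by omega)]
    rcases eq_or_lt_of_le (show carrelStart R i ≤ i - 1 by omega) with h3 | h3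
    · rw [← h3]
      have := gapless_carrelStart_le_of_isCritical hR hγ (.last _ (Or.inl h)) h2
      omega
    · rw [carrelStart_eq_of_carrel (n := n) (i := i) hi (k := i - 1) h3 (by omega)]
      have h4 := upperIncreasing_add_le hγ.1 (i := i - 1) (k := i) (by omega) (by omega) (by omega)
        (by rw [carrelEnd_eq_of_carrel h3 (by omega) hin.le]; omega)
      omega

theorem core_floorMap {γ : ℕ → ℕ} (hR : ∀ q ∈ R, 1 ≤ q ∧ q < n) (hγ : γ ∈ Gapless n R) :
    core n R (floorMap n R γ) = γ := by
  have hφ := floorMap_mem_upperFlag hR hγ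
  funext i
  by_cases h : i ∈ Finset.Icc 1 n
  swap
  · rw [hγ.1.1.1.2 i h]
    simp only [core]
    rw [if_neg h]
  obtain ⟨hi, hin⟩ := Finset.mem_Icc.1 h
  have hspec := carrelEnd_spec (R := R) hin
  have hen := carrelEnd_le_top (R := R) hin
  have hlt := carrelStart_lt (R := R) hi
  rw [core_eq_colMax hR hφ.1 hi hin]
  apply le_antisymm
  · by_cases h1 : γ (carrelStart R i) ≤ γ i
    · have := colMax_le hi hspec.2 (upper_le hφ.1 hen)
      rwa [floorMap_eq_max hR hγ hi hin, max_eq_right h1] at this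
    · rcases carrelStart_mem (R := R) hi with h2 | hq
      · rw [h2, upper_apply_zero hγ.1.1] at h1
        omega
      set q := carrelStart R i with hqdef
      have hend : carrelEnd n R (q + 1) = carrelEnd n R i :=
        carrelEnd_eq_of_carrel (by omega) (by omega) hin
      have h5 := upperIncreasing_add_le hγ.1 (i := q + 1) (k := i) (by omega) (by omega)
        (by omega) (by omega)
      obtain ⟨h3, h4⟩ := gapless_apply_add hγ hq (by omega) (v := γ q) (by omega) le_rfl
      have h6 : i ≤ q + 1 + (γ q - γ (q + 1)) := by omega
      have h7 := colMax_add_le hi (upper_le hφ.1 hen) h6 (by omega)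
      have h8 := upperIncreasing_add_le hγ.1 (i := q + 1) (k := q + 1 + (γ i - γ (q + 1)))
        (by omega) (by omega) (by omega) (by omega)
      have h9 := gapless_apply_add hγ hq (by omega) (v := γ i) (by omega) (by omega)
      have h10 : q + 1 + (γ i - γ (q + 1)) = i := by
        by_contra hne
        have := upperIncreasing_add_le hγ.1 (i := i) (k := q + 1 + (γ i - γ (q + 1)))
          (by omega) (by omega) (by omega) (by omega)
        omega
      rw [floorMap_eq_max hR hγ (by omega) (by omega),
        carrelStart_eq_of_carrel (n := n) (i := i) hi (by omega) (by omega), ← hqdef, h4, max_self] at h7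
      omega
  · rw [le_colMax_iff hi hspec.2 (upper_le hφ.1 hen)]
    intro k h1 h2
    rw [floorMap_eq_max hR hγ (by omega) (by omega)]
    exact (upperIncreasing_add_le hγ.1 hi hin h1 h2).trans (le_max_right _ _)

/-! ### Permutations and largest columns -/

/-- The set of the first `q` entries of a tuple. -/
def initial (π : ℕ → ℕ) (q : ℕ) : Finset ℕ := (Finset.Icc 1 q).image π

theorem mem_initial {π : ℕ → ℕ} {q x : ℕ} : x ∈ initial π q ↔ ∃ i, 1 ≤ i ∧ i ≤ q ∧ π i = x := by
  simp [initial, and_assoc]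

theorem initial_eq_image_Ioc (π : ℕ → ℕ) (q : ℕ) : initial π q = (Finset.Ioc 0 q).image π := rfl

theorem initial_subset {π : ℕ → ℕ} {q q' : ℕ} (h : q ≤ q') : initial π q ⊆ initial π q' :=
  Finset.image_subset_image (Finset.Icc_subset_Icc le_rfl h)

theorem card_initial {π : ℕ → ℕ} (hπ : π ∈ RPerm n R) {q : ℕ} (hq : q ≤ n) :
    (initial π q).card = q := by
  unfold initial
  rw [Finset.card_image_of_injOn]
  · simp
  · apply hπ.2.1.mono
    intro x hx
    rw [Finset.coe_Icc, Set.mem_Icc] at hx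
    exact ⟨hx.1, hx.2.trans hq⟩

theorem initial_strictMonoOn {π : ℕ → ℕ} (hπ : π ∈ RPerm n R) {q : ℕ} (hq : q ≤ n) :
    StrictMonoOn (fun i => rank (q - i + 1) (initial π q)) (Finset.Ioc 0 q) :=
  rank_strictMonoOn (by rw [card_initial hπ hq, Nat.sub_zero])

theorem image_rank_initial {π : ℕ → ℕ} (hπ : π ∈ RPerm n R) {q : ℕ} (hq : q ≤ n) :
    (Finset.Ioc 0 q).image (fun i => rank (q - i + 1) (initial π q)) = initial π q :=
  image_rank (by rw [card_initial hπ hq, Nat.sub_zero])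

theorem rank_mem_initial {π : ℕ → ℕ} (hπ : π ∈ RPerm n R) {q k : ℕ} (hq : q ≤ n) (hk : 1 ≤ k)
    (hkq : k ≤ q) : rank (q - k + 1) (initial π q) ∈ initial π q :=
  (rank_spec (by omega) (by rw [card_initial hπ hq]; omega)).1

theorem initial_top {π : ℕ → ℕ} (hπ : π ∈ RPerm n R) : initial π n = Finset.Icc 1 n := by
  apply Finset.eq_of_subset_of_card_le
  · intro x hx
    obtain ⟨i, h1, h2, rfl⟩ := mem_initial.1 hx
    exact hπ.1.1 i (Finset.mem_Icc.2 ⟨h1, h2⟩)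
  · rw [card_initial hπ le_rfl]; simp

theorem image_carrel {π : ℕ → ℕ} (hπ : π ∈ RPerm n R) {q q' : ℕ} (h : q ≤ q') (hq : q' ≤ n) :
    (Finset.Ioc q q').image π = initial π q' \ initial π q := by
  ext x
  simp only [Finset.mem_image, Finset.mem_Ioc, Finset.mem_sdiff, mem_initial]
  constructor
  · rintro ⟨i, h1, rfl⟩
    refine ⟨⟨i, by omega, by omega, rfl⟩, ?_⟩
    rintro ⟨k, h2, h3, h4⟩
    have := hπ.2.1 ⟨h2, by omega⟩ (⟨by omega, by omega⟩ : i ∈ Set.Icc 1 n) h4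
    omega
  · rintro ⟨⟨i, h1, h2, rfl⟩, h3⟩
    exact ⟨i, ⟨by by_contra h4; exact h3 ⟨i, h1, by omega, rfl⟩, h2⟩, rfl⟩

theorem rperm_strictMonoOn {π : ℕ → ℕ} (hπ : π ∈ RPerm n R) {i : ℕ} (hin : i ≤ n) :
    StrictMonoOn π (Finset.Ioc (carrelStart R i) (carrelEnd n R i)) := by
  intro j hj k hk hjk
  simp only [Finset.coe_Ioc, Set.mem_Ioc] at hj hk
  have hen := carrelEnd_le_top (R := R) hin
  exact hπ.2.2 j (Finset.mem_Icc.2 ⟨by omega, by omega⟩) k (Finset.mem_Icc.2 ⟨by omega, by omega⟩)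
    (by rw [carrelEnd_eq_of_carrel hj.1 hj.2 hin, carrelEnd_eq_of_carrel hk.1 hk.2 hin]) hjk

theorem rperm_apply {π : ℕ → ℕ} (hπ : π ∈ RPerm n R) {i : ℕ} (hi : 1 ≤ i) (hin : i ≤ n) :
    π i = rank (carrelEnd n R i - i + 1)
      (initial π (carrelEnd n R i) \ initial π (carrelStart R i)) := by
  have h1 := carrelStart_lt (R := R) hi
  have h2 := (carrelEnd_spec (R := R) hin).2
  rw [← image_carrel hπ (by omega) (carrelEnd_le_top hin),
    rank_image (rperm_strictMonoOn hπ hin) h1 h2]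

theorem rperm_ext {π π' : ℕ → ℕ} (hπ : π ∈ RPerm n R) (hπ' : π' ∈ RPerm n R)
    (h : ∀ q, IsDivider n R q → initial π q = initial π' q) : π = π' := by
  funext i
  by_cases hi : i ∈ Finset.Icc 1 n
  swap
  · rw [hπ.1.2 i hi, hπ'.1.2 i hi]
  obtain ⟨h1, hin⟩ := Finset.mem_Icc.1 hi
  rw [rperm_apply hπ h1 hin, rperm_apply hπ' h1 hin, h _ (carrelEnd_spec hin).1]
  rcases carrelStart_mem (R := R) h1 with h2 | h2
  · rw [h2]; rfl
  · rw [h _ (Or.inl h2)]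

/-- The columns of the key of `π` are the largest columns bounded by `β`. -/
def KeyEq (n : ℕ) (R : Finset ℕ) (β π : ℕ → ℕ) : Prop :=
  ∀ q, IsDivider n R q → ∀ i, 1 ≤ i → i ≤ q → rank (q - i + 1) (initial π q) = colMax β q i

theorem isDivider_le {q : ℕ} (hR : ∀ q ∈ R, 1 ≤ q ∧ q < n) (hq : IsDivider n R q) : q ≤ n := by
  rcases hq with h | h
  · exact (hR _ h).2.le
  · exact h.le

theorem KeyEq.initial_eq {β π : ℕ → ℕ} (hR : ∀ q ∈ R, 1 ≤ q ∧ q < n) (hπ : π ∈ RPerm n R)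
    (h : KeyEq n R β π) {q : ℕ} (hq : IsDivider n R q) : initial π q = initial (colMax β q) q := by
  rw [← image_rank_initial hπ (isDivider_le hR hq),
    initial_eq_image_Ioc (colMax β q)]
  apply Finset.image_congr
  intro i hi
  rw [Finset.coe_Ioc, Set.mem_Ioc] at hi
  exact h q hq i hi.1 hi.2

theorem KeyEq.unique {β π π' : ℕ → ℕ} (hR : ∀ q ∈ R, 1 ≤ q ∧ q < n) (hπ : π ∈ RPerm n R)
    (hπ' : π' ∈ RPerm n R) (h : KeyEq n R β π) (h' : KeyEq n R β π') : π = π' :=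
  rperm_ext hπ hπ' fun _ hq => by rw [h.initial_eq hR hπ hq, h'.initial_eq hR hπ' hq]

theorem KeyEq.core_eq_rankTuple {β π : ℕ → ℕ} (hR : ∀ q ∈ R, 1 ≤ q ∧ q < n) (hβ : β ∈ Upper n)
    (h : KeyEq n R β π) : core n R β = rankTuple n R π := by
  funext i
  by_cases hi : i ∈ Finset.Icc 1 n
  · obtain ⟨h1, hin⟩ := Finset.mem_Icc.1 hi
    rw [core_eq_colMax hR hβ h1 hin]
    have h2 := carrelEnd_spec (R := R) hin
    simp only [rankTuple]
    rw [if_pos hi]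
    exact (h _ h2.1 i h1 h2.2).symm
  · simp only [core, rankTuple]
    rw [if_neg hi, if_neg hi]

theorem KeyEq.of_core {β π : ℕ → ℕ} (hR : ∀ q ∈ R, 1 ≤ q ∧ q < n) (hβ : β ∈ Upper n) :
    KeyEq n R (core n R β) π ↔ KeyEq n R β π := by
  constructor
  · intro h q hq i h1 h2
    rw [h q hq i h1 h2, colMax_core hR hβ hq (isDivider_le hR hq) h1 h2]
  · intro h q hq i h1 h2
    rw [h q hq i h1 h2, colMax_core hR hβ hq (isDivider_le hR hq) h1 h2]

/-! ### The rank tuple of a 312-avoiding permutation -/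

theorem mem_initial_of_not_contains {π : ℕ → ℕ} (hπ : π ∈ RPerm312 n R)
    {q : ℕ} (hq : q ∈ R) (hqn : q < n) {x y v : ℕ} (hx : x ∈ initial π q)
    (hy : y ∈ initial π (carrelEnd n R (q + 1)) \ initial π q) (h1 : y ≤ v) (h2 : v ≤ x) :
    v ∈ initial π (carrelEnd n R (q + 1)) := by
  have hen := carrelEnd_le_top (R := R) (n := n) (i := q + 1) hqn
  have hqe := (carrelEnd_spec (R := R) (n := n) (i := q + 1) hqn).2
  rw [← image_carrel hπ.1 (by omega) hen] at hy
  obtain ⟨b, hb, rfl⟩ := Finset.mem_image.1 hy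
  rw [Finset.mem_Ioc] at hb
  obtain ⟨a, ha1, ha2, rfl⟩ := mem_initial.1 hx
  have hval : ∀ i, 1 ≤ i → i ≤ n → π i ∈ Finset.Icc 1 n := fun i hi1 hi2 =>
    hπ.1.1.1 i (Finset.mem_Icc.2 ⟨hi1, hi2⟩)
  have hv : v ∈ initial π n := by
    rw [initial_top hπ.1, Finset.mem_Icc]
    have h3 := Finset.mem_Icc.1 (hval a ha1 (by omega))
    have h4 := Finset.mem_Icc.1 (hval b (by omega) (by omega))
    omega
  obtain ⟨c, hc1, hc2, rfl⟩ := mem_initial.1 hv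
  rw [mem_initial]
  refine ⟨c, hc1, ?_, rfl⟩
  by_contra hc
  have hcb : π c ≠ π b := fun h => by
    have := hπ.1.2.1 ⟨hc1, hc2⟩ (⟨by omega, by omega⟩ : b ∈ Set.Icc 1 n) h
    omega
  have hca : π c ≠ π a := fun h => by
    have := hπ.1.2.1 ⟨hc1, hc2⟩ (⟨by omega, by omega⟩ : a ∈ Set.Icc 1 n) h
    omega
  exact hπ.2 ⟨q, hq, a, b, c, ha1, ha2, hb.1, hb.2, not_le.1 hc, hc2, by omega, by omega, by omega⟩

/-- Some element of `initial π q' \ initial π q` is at most `v` if the elements of `initial π q'`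
up to `v` outnumber those of `initial π q`. -/
theorem exists_new_le {π : ℕ → ℕ} (hπ : π ∈ RPerm n R) {q q' : ℕ} (hq : q ≤ n)
    (hqn : q' ≤ n) {k v : ℕ} (hk : 1 ≤ k) (hkq : k ≤ q') (hv : rank (q' - k + 1) (initial π q') ≤ v)
    (h : k ≤ q → v < rank (q - k + 1) (initial π q)) :
    ∃ y ∈ initial π q' \ initial π q, y ≤ v := by
  by_contra hcon
  push Not at hcon
  have hm' := initial_strictMonoOn hπ hqn
  have hm := initial_strictMonoOn hπ hq
  have hc := card_filter_le_image hm' (i := k) (by omega) hkq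
  rw [image_rank_initial hπ hqn] at hc
  have hS : ∀ y ∈ (initial π q').filter (fun y => y ≤ rank (q' - k + 1) (initial π q')),
      y ∈ initial π q ∧ y ≤ v := by
    intro y hy
    rw [Finset.mem_filter] at hy
    have hyv := hy.2.trans hv
    refine ⟨?_, hyv⟩
    by_contra h2
    have := hcon y (Finset.mem_sdiff.2 ⟨hy.1, h2⟩)
    omega
  by_cases hkq : k ≤ q
  · have h3 := apply_le_of_card_le hm (i := k) (v := v) hk hkq hc.ge (fun y hy => by
      rw [image_rank_initial hπ hq]
      exact hS y hy)
    have := h hkq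
    omega
  · have h3 := Finset.card_le_card (fun y hy => (hS y hy).1)
    rw [hc, card_initial hπ hq] at h3
    omega

theorem rankTuple_apply (π : ℕ → ℕ) {i : ℕ} (hi : 1 ≤ i) (hin : i ≤ n) :
    rankTuple n R π i = rank (carrelEnd n R i - i + 1) (initial π (carrelEnd n R i)) := by
  simp only [rankTuple]
  rw [if_pos (Finset.mem_Icc.2 ⟨hi, hin⟩)]
  rfl

theorem rankTuple_mem_upperIncreasing {π : ℕ → ℕ} (hπ : π ∈ RPerm n R) :
    rankTuple n R π ∈ UpperIncreasing n R := by
  constructor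
  · refine mem_upper_of (fun i hi hin => ?_) (fun i hi => by simp only [rankTuple]; rw [if_neg hi])
    rw [rankTuple_apply π hi hin]
    have hen := carrelEnd_le_top (R := R) hin
    have hie := (carrelEnd_spec (R := R) hin).2
    have hm := initial_strictMonoOn hπ hen
    have hsub := initial_subset (π := π) hen
    rw [initial_top hπ] at hsub
    have hmem := fun k h1 h2 => hsub (rank_mem_initial (k := k) hπ hen h1 h2)
    have h1 := Finset.mem_Icc.1 (hmem i hi hie)
    have h2 := Finset.mem_Icc.1 (hmem 1 le_rfl (by omega))
    have h3 := strictMonoOn_add_le hm (i := 1) (k := i) (by omega) hi hie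
    omega
  · intro i hi j hj he hij
    rw [Finset.mem_Icc] at hi hj
    rw [rankTuple_apply π hi.1 hi.2, rankTuple_apply π hj.1 hj.2, he]
    have hen := carrelEnd_le_top (R := R) hj.2
    have hje := (carrelEnd_spec (R := R) hj.2).2
    exact rank_lt_rank (by omega) (by omega) (by rw [card_initial hπ hen]; omega)

theorem rankTuple_mem_gapless {π : ℕ → ℕ} (hR : ∀ q ∈ R, 1 ≤ q ∧ q < n)
    (hπ : π ∈ RPerm312 n R) : rankTuple n R π ∈ Gapless n R := by
  refine mem_gapless_of hR (rankTuple_mem_upperIncreasing hπ.1) fun q hq v h1 h2 => ?_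
  obtain ⟨hq1, hqn⟩ := hR q hq
  have hen := carrelEnd_le_top (R := R) (n := n) (i := q + 1) hqn
  have hqe := (carrelEnd_spec (R := R) (n := n) (i := q + 1) hqn).2
  rw [rankTuple_apply π (by omega) (by omega)] at h1
  rw [rankTuple_apply π (by omega) (by omega), carrelEnd_of_isDivider hR (Or.inl hq)] at h2
  obtain ⟨y, hy, hyv⟩ := exists_new_le hπ.1 hqn.le hen (k := q + 1) (by omega) hqe h1
    (fun h => by omega)
  have hmem := mem_initial_of_not_contains hπ hq hqn
    (rank_mem_initial hπ.1 hqn.le hq1 le_rfl) hy hyv h2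
  have hm := initial_strictMonoOn hπ.1 hen
  rw [← image_rank_initial hπ.1 hen] at hmem
  obtain ⟨k, hk, hkv⟩ := Finset.mem_image.1 hmem
  rw [Finset.mem_Ioc] at hk
  have hqk : q < k := by
    by_contra hlt
    have := strictMonoOn_add_le hm (i := k) (k := q + 1) hk.1 (by omega) hqe
    omega
  refine ⟨k, hqk, hk.2, ?_⟩
  rw [rankTuple_apply π (by omega) (by omega), carrelEnd_eq_of_carrel (i := q + 1)
    (by rw [carrelStart_succ hq]; exact hqk) hk.2 hqn]
  exact hkv

theorem keyEq_rankTuple {π : ℕ → ℕ} (hn : 1 ≤ n) (hR : ∀ q ∈ R, 1 ≤ q ∧ q < n)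
    (hπ : π ∈ RPerm312 n R) : KeyEq n R (rankTuple n R π) π := by
  have hup := (rankTuple_mem_upperIncreasing hπ.1).1
  intro q hq
  refine isDivider_induction (P := fun q => ∀ i, 1 ≤ i → i ≤ q →
    rank (q - i + 1) (initial π q) = colMax (rankTuple n R π) q i) hR hn
    (fun i h1 h2 => by omega) ?_ hq
  intro q q' hq hqq' hq' hstart hdiv hqn ih i hi hiq
  have hm' := initial_strictMonoOn hπ.1 hqn
  have hcarrel : ∀ k, q < k → k ≤ q' → rank (q' - k + 1) (initial π q') = rankTuple n R π k := by
    intro k h1 h2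
    rw [rankTuple_apply π (by omega) (by omega), carrelEnd_eq_of_carrel (i := q')
      (by rw [hstart]; exact h1) (by rwa [carrelEnd_of_isDivider hR hdiv]) hqn,
      carrelEnd_of_isDivider hR hdiv]
  apply le_antisymm
  · rw [le_colMax_iff hi hiq (upper_le hup hqn)]
    intro k h1 h2
    refine (strictMonoOn_add_le hm' (by omega) h1 h2).trans ?_
    rw [rankTuple_apply π (by omega) (by omega)]
    have hken := carrelEnd_le_top (R := R) (h2.trans hqn)
    have hke := (carrelEnd_spec (R := R) (h2.trans hqn)).2
    have hmk := initial_strictMonoOn hπ.1 hken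
    have hck := card_filter_le_image hmk (i := k) (by omega) hke
    apply apply_le_of_card_le hm' (by omega) h2 hck.ge
    intro y hy
    rw [Finset.mem_filter, image_rank_initial hπ.1 hken] at hy
    rw [image_rank_initial hπ.1 hqn]
    exact ⟨initial_subset (carrelEnd_le hdiv h2) hy.1, hy.2⟩
  · by_cases hqi : q < i
    · rw [hcarrel i hqi hiq]
      exact colMax_le hi hiq (upper_le hup hqn)
    have hiq0 : i ≤ q := not_lt.1 hqi
    have hqR : q ∈ R := by
      rcases hq with h | h
      · omega
      · exact h
    by_cases hlt : rank (q' - i + 1) (initial π q') < rank (q - i + 1) (initial π q)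
    · obtain ⟨y, hy, hyv⟩ := exists_new_le hπ.1 (by omega) hqn hi hiq le_rfl (fun _ => hlt)
      have hmq := initial_strictMonoOn hπ.1 (by omega : q ≤ n)
      have h1 := strictMonoOn_add_le hmq (by omega) hiq0 le_rfl
      have h2 := strictMonoOn_consecutive hm' (i := i) (by omega) hiq (t := q + 1 - i) (by
        intro v hv1 hv2
        rw [image_rank_initial hπ.1 hqn]
        rw [hq'] at hy ⊢
        exact mem_initial_of_not_contains hπ hqR (by omega)
          (rank_mem_initial hπ.1 (by omega) (by omega : 1 ≤ q) le_rfl) hy (by omega) (by omega))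
      rw [show i + (q + 1 - i) = q + 1 by omega] at h2
      have h3 := colMax_add_le hi (upper_le hup hqn) (by omega : i ≤ q + 1) h2.1
      rw [← hcarrel (q + 1) (by omega) h2.1] at h3
      omega
    · refine le_trans ?_ (not_lt.1 hlt)
      rw [ih i hi hiq0]
      exact colMax_anti hi hiq0 hqq'.le (upper_le hup hqn)

/-! ### The permutation of a gapless tuple -/

theorem permOfAux_eq_zero (R : Finset ℕ) (γ : ℕ → ℕ) {k i : ℕ} (h : i = 0 ∨ k < i) :
    permOfAux R γ k i = 0 := by
  induction k with
  | zero => rfl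
  | succ k ih =>
    simp only [permOfAux]
    rw [Function.update_of_ne (by omega)]
    exact ih (by omega)

theorem permOfAux_stable (R : Finset ℕ) (γ : ℕ → ℕ) {k i : ℕ} (h : i ≤ k) :
    permOfAux R γ k i = permOfAux R γ i i := by
  induction k, h using Nat.le_induction with
  | base => rfl
  | succ k hk ih =>
    rw [← ih]
    simp only [permOfAux]
    rw [Function.update_of_ne (by omega)]

theorem permOf_apply (γ : ℕ → ℕ) {i : ℕ} (hi : 1 ≤ i) (hin : i ≤ n) :
    permOf n R γ i =
      if i ≤ carrelStart R i + overlap R γ (carrelStart R i) then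
        rank (carrelStart R i + overlap R γ (carrelStart R i) - i + 1)
          (Finset.Icc 1 (γ (carrelStart R i)) \ initial (permOf n R γ) (carrelStart R i))
      else γ i := by
  obtain ⟨k, rfl⟩ := Nat.exists_eq_add_of_le' hi
  have h1 := carrelStart_lt (R := R) hi
  have h2 : initial (permOf n R γ) (carrelStart R (k + 1)) =
      (Finset.Icc 1 (carrelStart R (k + 1))).image (permOfAux R γ k) := by
    unfold initial
    apply Finset.image_congr
    intro j hj
    rw [Finset.coe_Icc, Set.mem_Icc] at hj
    unfold permOf
    rw [permOfAux_stable R γ (by omega : j ≤ n), permOfAux_stable R γ (by omega : j ≤ k)]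
  rw [h2]
  unfold permOf
  rw [permOfAux_stable R γ hin]
  simp only [permOfAux]
  rw [Function.update_self]

theorem colMax_initial_step {γ : ℕ → ℕ} (hγ : γ ∈ Gapless n R)
    {q : ℕ} (hqn : q < n) {i : ℕ} (hi : 1 ≤ i) (hiq : i ≤ q) :
    colMax γ (carrelEnd n R (q + 1)) i =
      min (colMax γ q i) (γ (q + 1) - (q + 1 - i)) := by
  have hen := carrelEnd_le_top (R := R) (n := n) (i := q + 1) hqn
  have hqe := (carrelEnd_spec (R := R) (n := n) (i := q + 1) hqn).2
  have hup := upper_le hγ.1.1 hen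
  rw [colMax_eq_min hi hiq (by omega) hup]
  congr 2
  apply le_antisymm (colMax_le (by omega) hqe hup)
  rw [le_colMax_iff (by omega) hqe hup]
  exact fun k h1 h2 => upperIncreasing_add_le hγ.1 (by omega) hqn h1 h2

theorem colMax_eq_self_of_carrel {γ : ℕ → ℕ} (hγ : γ ∈ UpperIncreasing n R) {q' k : ℕ}
    (hR : ∀ q ∈ R, 1 ≤ q ∧ q < n) (hq' : IsDivider n R q') (hk : carrelStart R q' < k)
    (hkq : k ≤ q') : colMax γ q' k = γ k := by
  have hqn := isDivider_le hR hq'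
  have h1 : carrelEnd n R k = q' := by
    rw [carrelEnd_eq_of_carrel hk (by rwa [carrelEnd_of_isDivider hR hq']) hqn,
      carrelEnd_of_isDivider hR hq']
  have := colMax_of_carrel hR hγ (i := k) (by omega) (by omega)
  rwa [h1] at this

theorem mem_initial_of_between {γ : ℕ → ℕ} (hR : ∀ q ∈ R, 1 ≤ q ∧ q < n) (hγ : γ ∈ Gapless n R)
    {q : ℕ} (hq : q ∈ R) {y : ℕ} (h1 : γ (q + 1) ≤ y) (h2 : y ≤ γ q) :
    y ∈ initial (colMax γ (carrelEnd n R (q + 1))) (carrelEnd n R (q + 1)) := by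
  have hqn := (hR q hq).2
  obtain ⟨h3, h4⟩ := gapless_apply_add hγ hq hqn h1 h2
  refine mem_initial.2 ⟨q + 1 + (y - γ (q + 1)), by omega, h3, ?_⟩
  have hend : carrelEnd n R (q + 1 + (y - γ (q + 1))) = carrelEnd n R (q + 1) :=
    carrelEnd_eq_of_carrel (by rw [carrelStart_succ hq]; omega) h3 hqn
  have hen := carrelEnd_le_top (R := R) (n := n) (i := q + 1) hqn
  rw [← hend, colMax_of_carrel hR hγ.1 (by omega) (by omega), h4]

/-- If a row of the new column is not bounded by the old column, then the rows below it take
consecutive values up to the divider. -/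
theorem mem_initial_of_descent {γ : ℕ → ℕ} (hR : ∀ q ∈ R, 1 ≤ q ∧ q < n) (hγ : γ ∈ Gapless n R)
    {q : ℕ} (hq : q ∈ R) {i y : ℕ} (hi : 1 ≤ i) (hiq : i ≤ q)
    (hdesc : γ (q + 1) - (q + 1 - i) < colMax γ q i) (h1 : γ (q + 1) - (q + 1 - i) ≤ y)
    (h2 : y ≤ γ q) : y ∈ initial (colMax γ (carrelEnd n R (q + 1))) (carrelEnd n R (q + 1)) := by
  have hqn := (hR q hq).2
  rcases le_or_gt (γ (q + 1)) y with h3 | h3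
  · exact mem_initial_of_between hR hγ hq h3 h2
  have hqe := (carrelEnd_spec (R := R) (n := n) (i := q + 1) hqn).2
  have hup := upper_le hγ.1.1 (le_refl n) (q + 1) (by omega) hqn
  have h4 := colMax_add_le_colMax (k := q + 1 - (γ (q + 1) - y)) hi (upper_le hγ.1.1 hqn.le)
    (by omega) (by omega)
  refine mem_initial.2 ⟨q + 1 - (γ (q + 1) - y), by omega, by omega, ?_⟩
  rw [colMax_initial_step hγ hqn (by omega) (by omega)]
  omega

theorem initial_colMax_subset {γ : ℕ → ℕ} (hR : ∀ q ∈ R, 1 ≤ q ∧ q < n) (hγ : γ ∈ Gapless n R)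
    {q : ℕ} (hq : q ∈ R) : initial (colMax γ q) q ⊆
      initial (colMax γ (carrelEnd n R (q + 1))) (carrelEnd n R (q + 1)) := by
  intro x hx
  obtain ⟨i, hi, hiq, rfl⟩ := mem_initial.1 hx
  have hqn := (hR q hq).2
  have hqe := (carrelEnd_spec (R := R) (n := n) (i := q + 1) hqn).2
  by_cases hdesc : γ (q + 1) - (q + 1 - i) < colMax γ q i
  · exact mem_initial_of_descent hR hγ hq hi hiq hdesc hdesc.le
      (colMax_le_self hi hiq (upper_le hγ.1.1 hqn.le))
  · refine mem_initial.2 ⟨i, hi, by omega, ?_⟩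
    rw [colMax_initial_step hγ hqn hi hiq, min_eq_left (not_lt.1 hdesc)]

theorem mem_initial_colMax_of_new_le {γ : ℕ → ℕ} (hR : ∀ q ∈ R, 1 ≤ q ∧ q < n)
    (hγ : γ ∈ Gapless n R) {q : ℕ} (hq : q ∈ R) {x y : ℕ}
    (hx : x ∈ initial (colMax γ (carrelEnd n R (q + 1))) (carrelEnd n R (q + 1)) \
      initial (colMax γ q) q) (h1 : x ≤ y) (h2 : y ≤ γ q) :
    y ∈ initial (colMax γ (carrelEnd n R (q + 1))) (carrelEnd n R (q + 1)) := by
  rw [Finset.mem_sdiff] at hx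
  obtain ⟨i, hi, hie, rfl⟩ := mem_initial.1 hx.1
  have hqn := (hR q hq).2
  have hqe := (carrelEnd_spec (R := R) (n := n) (i := q + 1) hqn).2
  rcases le_or_gt i q with hiq | hiq
  · rw [colMax_initial_step hγ hqn hi hiq] at h1 hx
    by_cases hdesc : γ (q + 1) - (q + 1 - i) < colMax γ q i
    · exact mem_initial_of_descent hR hγ hq hi hiq hdesc (by omega) h2
    · rw [min_eq_left (not_lt.1 hdesc)] at hx
      exact absurd (mem_initial.2 ⟨i, hi, hiq, rfl⟩) hx.2
  · apply mem_initial_of_between hR hγ hq ?_ h2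
    have hend : carrelEnd n R i = carrelEnd n R (q + 1) :=
      carrelEnd_eq_of_carrel (by rw [carrelStart_succ hq]; omega) hie hqn
    have hen := carrelEnd_le_top (R := R) (n := n) (i := q + 1) hqn
    rw [← hend, colMax_of_carrel hR hγ.1 (by omega) (by omega)] at h1
    have := upperIncreasing_add_le hγ.1 (i := q + 1) (k := i) (by omega) hqn hiq hie
    omega

theorem card_initial_colMax {γ : ℕ → ℕ} (hγ : γ ∈ Upper n) {q : ℕ} (hq : q ≤ n) :
    (initial (colMax γ q) q).card = q := by
  rw [initial_eq_image_Ioc,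
    Finset.card_image_of_injOn (colMax_strictMonoOn (upper_le hγ hq)).injOn]
  simp

theorem le_of_mem_initial_colMax {γ : ℕ → ℕ} (hγ : γ ∈ Upper n) {q x : ℕ} (hq : q ≤ n)
    (hx : x ∈ initial (colMax γ q) q) : x ≤ γ q := by
  obtain ⟨i, hi, hiq, rfl⟩ := mem_initial.1 hx
  exact colMax_le_self hi hiq (upper_le hγ hq)

theorem permOf_spec {γ : ℕ → ℕ} (hn : 1 ≤ n) (hR : ∀ q ∈ R, 1 ≤ q ∧ q < n)
    (hγ : γ ∈ Gapless n R) {q : ℕ} (hq : IsDivider n R q) :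
    initial (permOf n R γ) q = initial (colMax γ q) q ∧
    ∀ i, carrelStart R q < i → i ≤ q → permOf n R γ i =
      rank (q - i + 1) (initial (colMax γ q) q \
        initial (colMax γ (carrelStart R q)) (carrelStart R q)) := by
  refine isDivider_induction (P := fun q => initial (permOf n R γ) q = initial (colMax γ q) q ∧
    ∀ i, carrelStart R q < i → i ≤ q → permOf n R γ i =
      rank (q - i + 1) (initial (colMax γ q) q \
        initial (colMax γ (carrelStart R q)) (carrelStart R q))) hR hn
    ⟨rfl, fun i h1 h2 => by omega⟩ ?_ hq
  rintro q q' hq hqq' hq' hstart hdiv hqn ⟨ih, -⟩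
  rw [hstart]
  have hsub : initial (colMax γ q) q ⊆ initial (colMax γ q') q' := by
    rcases hq with h | h
    · subst h; exact Finset.empty_subset _
    · rw [hq']; exact initial_colMax_subset hR hγ h
  have hcard : (initial (colMax γ q') q' \ initial (colMax γ q) q).card = q' - q := by
    rw [Finset.card_sdiff_of_subset hsub, card_initial_colMax hγ.1.1 hqn,
      card_initial_colMax hγ.1.1 (by omega)]
  have hm := colMax_strictMonoOn (upper_le hγ.1.1 hqn)
  have hval : ∀ k, q < k → k ≤ q' → colMax γ q' k = γ k := fun k h1 h2 =>
    colMax_eq_self_of_carrel hγ.1 hR hdiv (by rwa [hstart]) h2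
  have hold : ∀ x ∈ initial (colMax γ q) q, x ≤ γ q := fun x hx =>
    le_of_mem_initial_colMax hγ.1.1 (by omega) hx
  have hqe : carrelEnd n R (q + 1) = q' := hq'.symm
  have happly : ∀ i, q < i → i ≤ q' → permOf n R γ i =
      rank (q' - i + 1) (initial (colMax γ q') q' \ initial (colMax γ q) q) := by
    intro i hi hiq
    have hsi : carrelStart R i = q := by
      rw [carrelStart_eq_of_carrel (n := n) (i := q') (by omega) (by omega)
        (by rwa [carrelEnd_of_isDivider hR hdiv]), hstart]
    rw [permOf_apply γ (by omega) (by omega), hsi, ih]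
    split_ifs with hov
    · have hov' : q ∈ R ∧ γ (q + 1) ≤ γ q := by
        by_contra hno
        unfold overlap at hov
        rw [if_neg hno] at hov
        omega
      obtain ⟨hqR, hle⟩ := hov'
      have hs : overlap R γ q = γ q - γ (q + 1) + 1 := if_pos ⟨hqR, hle⟩
      obtain ⟨hb1, hb2⟩ := gapless_apply_add hγ hqR (by omega) hle le_rfl
      have hqs : q + 1 + (γ q - γ (q + 1)) = q + overlap R γ q := by omega
      rw [hqs, hqe] at hb1
      rw [hqs] at hb2
      set s := overlap R γ q with hsdef
      obtain ⟨hxmem, hxcard⟩ := rank_spec (d := q' - i + 1)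
        (Q := initial (colMax γ q') q' \ initial (colMax γ q) q) (by omega) (by omega)
      set x := rank (q' - i + 1) (initial (colMax γ q') q' \ initial (colMax γ q) q) with hxdef
      have hgt : ((initial (colMax γ q') q' \ initial (colMax γ q) q).filter
          (fun y => γ q < y)).card = q' - (q + s) := by
        have h1 : (initial (colMax γ q') q' \ initial (colMax γ q) q).filter (fun y => γ q < y) =
            ((initial (colMax γ q') q').filter (fun y => γ q ≤ y)).erase (γ q) := by
          ext y
          simp only [Finset.mem_filter, Finset.mem_sdiff, Finset.mem_erase]
          constructor
          · rintro ⟨⟨h1, h2⟩, h3⟩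
            exact ⟨by omega, h1, by omega⟩
          · rintro ⟨h1, h2, h3⟩
            refine ⟨⟨h2, fun h4 => ?_⟩, by omega⟩
            have := hold y h4
            omega
        have h2 := card_filter_image hm (i := q + s) (by omega) hb1
        rw [hval _ (by omega) hb1, hb2] at h2
        rw [h1, Finset.card_erase_of_mem, initial_eq_image_Ioc, h2]
        · omega
        · rw [Finset.mem_filter]
          exact ⟨mem_initial.2 ⟨q + s, by omega, hb1, by rw [hval _ (by omega) hb1, hb2]⟩, le_rfl⟩
      have hxq : x ≤ γ q := by
        by_contra hlt
        have h1 : (initial (colMax γ q') q' \ initial (colMax γ q) q).filter (fun y => x ≤ y) ⊆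
            (initial (colMax γ q') q' \ initial (colMax γ q) q).filter (fun y => γ q < y) := by
          intro y hy
          rw [Finset.mem_filter] at hy ⊢
          exact ⟨hy.1, by omega⟩
        have := Finset.card_le_card h1
        omega
      have hx1 : 1 ≤ x := by
        obtain ⟨k, hk1, hk2, hk3⟩ := mem_initial.1 (Finset.mem_sdiff.1 hxmem).1
        have := le_colMax hk1 hk2 (upper_le hγ.1.1 hqn)
        omega
      apply rank_eq
      · rw [Finset.mem_sdiff, Finset.mem_Icc]
        exact ⟨⟨hx1, hxq⟩, (Finset.mem_sdiff.1 hxmem).2⟩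
      · have h1 : (initial (colMax γ q') q' \ initial (colMax γ q) q).filter (fun y => x ≤ y) =
            (Finset.Icc 1 (γ q) \ initial (colMax γ q) q).filter (fun y => x ≤ y) ∪
            (initial (colMax γ q') q' \ initial (colMax γ q) q).filter (fun y => γ q < y) := by
          ext y
          simp only [Finset.mem_filter, Finset.mem_sdiff, Finset.mem_union, Finset.mem_Icc]
          constructor
          · rintro ⟨⟨h1, h2⟩, h3⟩
            by_cases h4 : γ q < y
            · exact Or.inr ⟨⟨h1, h2⟩, h4⟩
            · exact Or.inl ⟨⟨⟨by omega, by omega⟩, h2⟩, h3⟩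
          · rintro (⟨⟨⟨h1, h2⟩, h3⟩, h4⟩ | ⟨⟨h1, h2⟩, h3⟩)
            · refine ⟨⟨?_, h3⟩, h4⟩
              have := mem_initial_colMax_of_new_le hR hγ hqR (x := x) (y := y)
                (by rw [hqe]; exact hxmem) h4 h2
              rwa [hqe] at this
            · exact ⟨⟨h1, h2⟩, by omega⟩
        rw [h1, Finset.card_union_of_disjoint, hgt] at hxcard
        · omega
        · rw [Finset.disjoint_left]
          intro y hy1 hy2
          simp only [Finset.mem_filter, Finset.mem_sdiff, Finset.mem_Icc] at hy1 hy2
          omega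
    · have hgt : γ q < γ i := by
        have h1 := upperIncreasing_add_le hγ.1 (i := q + 1) (k := i) (by omega) (by omega) hi
          (by rwa [hqe])
        have h2 := upper_le hγ.1.1 (le_refl n) (q + 1) (by omega) (by omega)
        by_cases hov' : q ∈ R ∧ γ (q + 1) ≤ γ q
        · have hs : overlap R γ q = γ q - γ (q + 1) + 1 := if_pos hov'
          omega
        · rcases hq with h | h
          · subst h
            rw [upper_apply_zero hγ.1.1]
            omega
          · have : ¬ γ (q + 1) ≤ γ q := fun h3 => hov' ⟨h, h3⟩
            omega
      symm
      apply rank_eq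
      · rw [Finset.mem_sdiff]
        refine ⟨mem_initial.2 ⟨i, by omega, hiq, hval i hi hiq⟩, fun h => ?_⟩
        have := hold _ h
        omega
      · have h2 := card_filter_image hm (i := i) (by omega) hiq
        rw [hval i hi hiq] at h2
        rw [← h2, ← initial_eq_image_Ioc]
        congr 1
        ext y
        simp only [Finset.mem_filter, Finset.mem_sdiff]
        constructor
        · rintro ⟨⟨h1, -⟩, h3⟩
          exact ⟨h1, h3⟩
        · rintro ⟨h1, h3⟩
          refine ⟨⟨h1, fun h4 => ?_⟩, h3⟩
          have := hold _ h4
          omega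
  refine ⟨?_, happly⟩
  have h1 : initial (permOf n R γ) q' =
      initial (permOf n R γ) q ∪ (Finset.Ioc q q').image (permOf n R γ) := by
    rw [initial_eq_image_Ioc, initial_eq_image_Ioc, ← Finset.image_union,
      Finset.Ioc_union_Ioc_eq_Ioc (by omega) hqq'.le]
  have h2 : (Finset.Ioc q q').image (permOf n R γ) =
      initial (colMax γ q') q' \ initial (colMax γ q) q := by
    rw [← image_rank hcard]
    apply Finset.image_congr
    intro i hi
    rw [Finset.coe_Ioc, Set.mem_Ioc] at hi
    exact happly i hi.1 hi.2
  rw [h1, h2, ih, Finset.union_sdiff_of_subset hsub]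

theorem permOf_mem_rperm {γ : ℕ → ℕ} (hn : 1 ≤ n) (hR : ∀ q ∈ R, 1 ≤ q ∧ q < n)
    (hγ : γ ∈ Gapless n R) : permOf n R γ ∈ RPerm n R := by
  have htop : initial (permOf n R γ) n = Finset.Icc 1 n := by
    rw [(permOf_spec hn hR hγ (Or.inr rfl)).1]
    ext x
    rw [mem_initial, Finset.mem_Icc]
    constructor
    · rintro ⟨i, h1, h2, rfl⟩
      rw [colMax_top hγ.1.1 h1 h2]
      exact ⟨h1, h2⟩
    · rintro ⟨h1, h2⟩
      exact ⟨x, h1, h2, colMax_top hγ.1.1 h1 h2⟩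
  refine ⟨⟨fun i hi => ?_, fun i hi => ?_⟩, ?_, ?_⟩
  · rw [← htop]
    exact Finset.mem_image_of_mem _ hi
  · rw [Finset.mem_Icc] at hi
    exact permOfAux_eq_zero R γ (by omega)
  · rw [← Finset.coe_Icc]
    apply Finset.injOn_of_card_image_eq
    exact congrArg Finset.card htop
  · intro i hi j hj he hij
    rw [Finset.mem_Icc] at hi hj
    have hdiv := (carrelEnd_spec (R := R) hj.2).1
    have hje := (carrelEnd_spec (R := R) hj.2).2
    have hen := carrelEnd_le_top (R := R) hj.2
    have hsj := carrelStart_lt (R := R) hj.1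
    have hsi := carrelStart_lt (R := R) hi.1
    have hst : carrelStart R (carrelEnd n R j) = carrelStart R j :=
      carrelStart_eq_of_carrel hj.1 (by omega) le_rfl
    have hst' : carrelStart R (carrelEnd n R i) = carrelStart R i :=
      carrelStart_eq_of_carrel hi.1 (by have := (carrelEnd_spec (R := R) hi.2).2; omega) le_rfl
    obtain ⟨h1, h2⟩ := permOf_spec hn hR hγ hdiv
    rw [h2 i (by rw [← he, hst']; exact hsi) (by omega), h2 j (by rw [hst]; exact hsj) hje]
    refine rank_lt_rank (by omega) (by omega) ?_
    have hc := Finset.le_card_sdiff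
      (initial (colMax γ (carrelStart R (carrelEnd n R j))) (carrelStart R (carrelEnd n R j)))
      (initial (colMax γ (carrelEnd n R j)) (carrelEnd n R j))
    rw [card_initial_colMax hγ.1.1 hen, card_initial_colMax hγ.1.1 (by omega)] at hc
    rw [he, hst] at hst'
    omega

theorem permOf_mem_rperm312 {γ : ℕ → ℕ} (hn : 1 ≤ n) (hR : ∀ q ∈ R, 1 ≤ q ∧ q < n)
    (hγ : γ ∈ Gapless n R) : permOf n R γ ∈ RPerm312 n R := by
  have hπ := permOf_mem_rperm hn hR hγ
  refine ⟨hπ, ?_⟩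
  rintro ⟨q, hq, a, b, c, ha, haq, hqb, hbe, hec, hcn, hba, hbc, hca⟩
  have hqn := (hR q hq).2
  have hdiv' := (carrelEnd_spec (R := R) (n := n) (i := q + 1) hqn).1
  have hq1 := (permOf_spec hn hR hγ (Or.inl hq)).1
  have hq2 := (permOf_spec hn hR hγ hdiv').1
  have hb : permOf n R γ b ∈ initial (permOf n R γ) (carrelEnd n R (q + 1)) \
      initial (permOf n R γ) q := by
    rw [← image_carrel hπ (by omega) (by omega)]
    exact Finset.mem_image_of_mem _ (Finset.mem_Ioc.2 ⟨hqb, hbe⟩)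
  have haγ : permOf n R γ a ≤ γ q := by
    apply le_of_mem_initial_colMax hγ.1.1 hqn.le
    rw [← hq1]
    exact mem_initial.2 ⟨a, ha, haq, rfl⟩
  rw [hq1, hq2] at hb
  have hc := mem_initial_colMax_of_new_le hR hγ hq hb hbc.le (by omega)
  rw [← hq2] at hc
  obtain ⟨k, hk1, hk2, hk3⟩ := mem_initial.1 hc
  have := hπ.2.1 ⟨hk1, by omega⟩ (⟨by omega, hcn⟩ : c ∈ Set.Icc 1 n) hk3
  omega

theorem keyEq_permOf {γ : ℕ → ℕ} (hn : 1 ≤ n) (hR : ∀ q ∈ R, 1 ≤ q ∧ q < n)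
    (hγ : γ ∈ Gapless n R) : KeyEq n R γ (permOf n R γ) := by
  intro q hq i hi hiq
  rw [(permOf_spec hn hR hγ hq).1, initial_eq_image_Ioc,
    rank_image (colMax_strictMonoOn (upper_le hγ.1.1 (isDivider_le hR hq))) hi hiq]

/-! ### Shapes -/

theorem colLen_le (n : ℕ) (lam : ℕ → ℕ) (j : ℕ) : colLen n lam j ≤ n := by
  unfold colLen
  simpa using Finset.card_filter_le (Finset.Icc 1 n) (fun i => j ≤ lam i)

theorem colLen_anti (n : ℕ) (lam : ℕ → ℕ) : Antitone (colLen n lam) := by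
  intro j j' h
  apply Finset.card_le_card
  intro i hi
  rw [Finset.mem_filter] at hi ⊢
  exact ⟨hi.1, h.trans hi.2⟩

theorem one_le_colLen (hn : 1 ≤ n) {j : ℕ} (hj : j ≤ lam 1) : 1 ≤ colLen n lam j :=
  Finset.card_pos.2 ⟨1, by simp [hn, hj]⟩

theorem le_of_colLen_pos (hlam : lam ∈ Partitions n) {j : ℕ} (h : 0 < colLen n lam j) :
    j ≤ lam 1 := by
  obtain ⟨i, hi⟩ := Finset.card_pos.1 h
  rw [Finset.mem_filter, Finset.mem_Icc] at hi
  exact hi.2.trans (hlam.1 ⟨le_rfl, by omega⟩ ⟨hi.1.1, hi.1.2⟩ hi.1.1)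

theorem isBox_of_le_colLen (hlam : lam ∈ Partitions n) {j i : ℕ} (hj : 1 ≤ j) (hi : 1 ≤ i)
    (h : i ≤ colLen n lam j) : IsBox n lam j i :=
  ⟨hj, le_of_colLen_pos hlam (by omega), hi, h⟩

theorem shapeR_bounds (hn : 1 ≤ n) : ∀ q ∈ shapeR n lam, 1 ≤ q ∧ q < n := by
  intro q hq
  unfold shapeR at hq
  rw [Finset.mem_filter, Finset.mem_image] at hq
  obtain ⟨⟨j, hj, rfl⟩, hne⟩ := hq
  rw [Finset.mem_Icc] at hj
  have := colLen_le n lam j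
  exact ⟨one_le_colLen hn hj.2, by omega⟩

theorem exists_colLen_eq {q : ℕ} (hq : q ∈ shapeR n lam) :
    ∃ j, 1 ≤ j ∧ j ≤ lam 1 ∧ colLen n lam j = q := by
  unfold shapeR at hq
  rw [Finset.mem_filter, Finset.mem_image] at hq
  obtain ⟨⟨j, hj, rfl⟩, -⟩ := hq
  rw [Finset.mem_Icc] at hj
  exact ⟨j, hj.1, hj.2, rfl⟩

theorem isDivider_colLen {j : ℕ} (hj : 1 ≤ j) (hj' : j ≤ lam 1) :
    IsDivider n (shapeR n lam) (colLen n lam j) := by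
  by_cases h : colLen n lam j = n
  · exact Or.inr h
  · refine Or.inl ?_
    unfold shapeR
    rw [Finset.mem_filter, Finset.mem_image]
    exact ⟨⟨j, by rw [Finset.mem_Icc]; exact ⟨hj, hj'⟩, rfl⟩, h⟩

/-! ### Row bound max tableaux -/

open Classical in
/-- The largest tableau with rows bounded by `β`. -/
noncomputable def rowMax (n : ℕ) (lam : ℕ → ℕ) (β : ℕ → ℕ) : ℕ → ℕ → ℕ := fun j i =>
  if IsBox n lam j i then colMax β (colLen n lam j) i else 0

theorem rowMax_of_box {β : ℕ → ℕ} {j i : ℕ} (h : IsBox n lam j i) :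
    rowMax n lam β j i = colMax β (colLen n lam j) i := if_pos h

theorem rowMax_of_not_box {β : ℕ → ℕ} {j i : ℕ} (h : ¬ IsBox n lam j i) :
    rowMax n lam β j i = 0 := if_neg h

theorem tableau_strictMonoOn {T : ℕ → ℕ → ℕ} (hT : T ∈ Tableaux n lam) {j : ℕ} (hj : 1 ≤ j)
    (hj' : j ≤ lam 1) : StrictMonoOn (T j) (Finset.Ioc 0 (colLen n lam j)) := by
  intro i hi k hk hik
  rw [Finset.coe_Ioc, Set.mem_Ioc] at hi hk
  exact hT.2.2.1 j i k ⟨hj, hj', hi⟩ ⟨hj, hj', hk⟩ hik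

theorem rowMax_mem_rowBoundSet {β : ℕ → ℕ} (hβ : β ∈ Upper n) :
    rowMax n lam β ∈ RowBoundSet n lam β := by
  have hup : ∀ j, ∀ k, 1 ≤ k → k ≤ colLen n lam j → k ≤ β k := fun j =>
    upper_le hβ (colLen_le n lam j)
  refine ⟨⟨?_, fun j i h => rowMax_of_not_box h, ?_, ?_⟩, hβ.2, ?_⟩
  · intro j i h
    rw [rowMax_of_box h, Finset.mem_Icc]
    have h1 := le_colMax h.2.2.1 h.2.2.2 (hup j)
    have h2 := colMax_le h.2.2.1 h.2.2.2 (hup j)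
    have h3 := upper_le_top hβ h.2.2.1 (h.2.2.2.trans (colLen_le n lam j))
    have := h.2.2.1
    omega
  · intro j i i' h h' hii
    rw [rowMax_of_box h, rowMax_of_box h']
    have := colMax_add_le_colMax h.2.2.1 (hup j) hii.le h'.2.2.2
    omega
  · intro j j' i h h' hjj
    rw [rowMax_of_box h, rowMax_of_box h']
    exact colMax_anti h.2.2.1 h'.2.2.2 (colLen_anti n lam hjj) (hup j)
  · intro j i h
    rw [rowMax_of_box h]
    exact colMax_le h.2.2.1 h.2.2.2 (hup j)

theorem le_rowMax {β : ℕ → ℕ} (hβ : β ∈ Upper n) {F : ℕ → ℕ → ℕ}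
    (h0 : ∀ j i, ¬ IsBox n lam j i → F j i = 0)
    (hF : ∀ j, 1 ≤ j → j ≤ lam 1 → StrictMonoOn (F j) (Finset.Ioc 0 (colLen n lam j)))
    (hb : ∀ j i, IsBox n lam j i → F j i ≤ β i) : F ≤ rowMax n lam β := by
  intro j i
  by_cases h : IsBox n lam j i
  · rw [rowMax_of_box h, le_colMax_iff h.2.2.1 h.2.2.2 (upper_le hβ (colLen_le n lam j))]
    intro k h1 h2
    exact (strictMonoOn_add_le (hF j h.1 h.2.1) h.2.2.1 h1 h2).trans
      (hb j k ⟨h.1, h.2.1, h.2.2.1.trans h1, h2⟩)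
  · rw [h0 j i h]; exact Nat.zero_le _

theorem le_rowMax_of_mem {β : ℕ → ℕ} (hβ : β ∈ Upper n) {T : ℕ → ℕ → ℕ}
    (hT : T ∈ RowBoundSet n lam β) : T ≤ rowMax n lam β :=
  le_rowMax hβ hT.1.2.1 (fun _ hj hj' => tableau_strictMonoOn hT.1 hj hj') hT.2.2

theorem mem_rowBoundSet_iff {β : ℕ → ℕ} (hβ : β ∈ Upper n) {T : ℕ → ℕ → ℕ} :
    T ∈ RowBoundSet n lam β ↔ T ∈ Tableaux n lam ∧ T ≤ rowMax n lam β := by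
  constructor
  · exact fun h => ⟨h.1, le_rowMax_of_mem hβ h⟩
  · intro h
    exact ⟨h.1, hβ.2, fun j i hb => (h.2 j i).trans ((rowMax_mem_rowBoundSet hβ).2.2 j i hb)⟩

theorem rowMax_core {β : ℕ → ℕ} (hn : 1 ≤ n) (hβ : β ∈ Upper n) :
    rowMax n lam (core n (shapeR n lam) β) = rowMax n lam β := by
  funext j i
  by_cases h : IsBox n lam j i
  · rw [rowMax_of_box h, rowMax_of_box h, colMax_core (shapeR_bounds hn) hβ
      (isDivider_colLen h.1 h.2.1) (colLen_le n lam j) h.2.2.1 h.2.2.2]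
  · rw [rowMax_of_not_box h, rowMax_of_not_box h]

theorem rowBoundSet_core {β : ℕ → ℕ} (hn : 1 ≤ n) (hβ : β ∈ Upper n) :
    RowBoundSet n lam (core n (shapeR n lam) β) = RowBoundSet n lam β := by
  ext T
  rw [mem_rowBoundSet_iff hβ,
    mem_rowBoundSet_iff (core_mem_upperIncreasing (shapeR_bounds hn) hβ).1, rowMax_core hn hβ]

theorem rowMax_eq_of_rowBoundSet_eq {β β' : ℕ → ℕ} (hβ : β ∈ Upper n) (hβ' : β' ∈ Upper n)
    (h : RowBoundSet n lam β = RowBoundSet n lam β') : rowMax n lam β = rowMax n lam β' :=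
  le_antisymm (le_rowMax_of_mem hβ' (h ▸ rowMax_mem_rowBoundSet hβ))
    (le_rowMax_of_mem hβ (h ▸ rowMax_mem_rowBoundSet hβ'))

theorem colMax_eq_of_rowMax_eq {β β' : ℕ → ℕ} (hβ : β ∈ Upper n) (hβ' : β' ∈ Upper n)
    (h : rowMax n lam β = rowMax n lam β') {q i : ℕ} (hq : IsDivider n (shapeR n lam) q)
    (hi : 1 ≤ i) (hiq : i ≤ q) : colMax β q i = colMax β' q i := by
  rcases hq with hq | rfl
  · obtain ⟨j, hj, hj', rfl⟩ := exists_colLen_eq hq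
    have hb : IsBox n lam j i := ⟨hj, hj', hi, hiq⟩
    rw [← rowMax_of_box hb, h, rowMax_of_box hb]
  · rw [colMax_top hβ hi hiq, colMax_top hβ' hi hiq]

theorem core_eq_of_rowBoundSet_eq {β β' : ℕ → ℕ} (hn : 1 ≤ n) (hβ : β ∈ Upper n)
    (hβ' : β' ∈ Upper n) (h : RowBoundSet n lam β = RowBoundSet n lam β') :
    core n (shapeR n lam) β = core n (shapeR n lam) β' := by
  have hR := shapeR_bounds (lam := lam) hn
  funext i
  by_cases hi : i ∈ Finset.Icc 1 n
  · obtain ⟨h1, hin⟩ := Finset.mem_Icc.1 hi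
    have h2 := carrelEnd_spec (R := shapeR n lam) hin
    rw [core_eq_colMax hR hβ h1 hin, core_eq_colMax hR hβ' h1 hin]
    exact colMax_eq_of_rowMax_eq hβ hβ' (rowMax_eq_of_rowBoundSet_eq hβ hβ' h) h2.1 h1 h2.2
  · simp only [core]
    rw [if_neg hi, if_neg hi]

/-! ### Keys -/

theorem key_of_box {π : ℕ → ℕ} {j i : ℕ} (h : IsBox n lam j i) :
    key n lam π j i = rank (colLen n lam j - i + 1) (initial π (colLen n lam j)) := by
  have := h.2.2.2
  simp only [key]
  rw [if_pos h, show colLen n lam j + 1 - i = colLen n lam j - i + 1 by omega]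
  rfl

theorem key_of_not_box {π : ℕ → ℕ} {j i : ℕ} (h : ¬ IsBox n lam j i) : key n lam π j i = 0 :=
  if_neg h

theorem key_mem_initial {π : ℕ → ℕ} (hπ : π ∈ RPerm n R) {j i : ℕ} (h : IsBox n lam j i) :
    key n lam π j i ∈ initial π (colLen n lam j) := by
  rw [key_of_box h]
  exact rank_mem_initial hπ (colLen_le n lam j) h.2.2.1 h.2.2.2

theorem key_mem_tableaux {π : ℕ → ℕ} (hπ : π ∈ RPerm n R) : key n lam π ∈ Tableaux n lam := by
  refine ⟨?_, fun j i h => key_of_not_box h, ?_, ?_⟩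
  · intro j i h
    have := initial_subset (π := π) (colLen_le n lam j) (key_mem_initial hπ h)
    rwa [initial_top hπ] at this
  · intro j i i' h h' hii
    rw [key_of_box h, key_of_box h']
    exact initial_strictMonoOn hπ (colLen_le n lam j) (Finset.mem_coe.2 (Finset.mem_Ioc.2 h.2.2))
      (Finset.mem_coe.2 (Finset.mem_Ioc.2 h'.2.2)) hii
  · intro j j' i h h' hjj
    rw [key_of_box h, key_of_box h']
    have hm := initial_strictMonoOn hπ (colLen_le n lam j)
    have hm' := initial_strictMonoOn hπ (colLen_le n lam j')
    have hc := card_filter_le_image hm' h'.2.2.1 h'.2.2.2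
    apply apply_le_of_card_le hm h.2.2.1 h.2.2.2 hc.ge
    intro y hy
    rw [Finset.mem_filter, image_rank_initial hπ (colLen_le n lam j')] at hy
    rw [image_rank_initial hπ (colLen_le n lam j)]
    exact ⟨initial_subset (colLen_anti n lam hjj) hy.1, hy.2⟩

theorem key_eq_rowMax_iff {β π : ℕ → ℕ} (hβ : β ∈ Upper n)
    (hπ : π ∈ RPerm n (shapeR n lam)) :
    key n lam π = rowMax n lam β ↔ KeyEq n (shapeR n lam) β π := by
  constructor
  · rintro h q (hq | rfl) i hi hiq
    · obtain ⟨j, hj, hj', rfl⟩ := exists_colLen_eq hq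
      have hb : IsBox n lam j i := ⟨hj, hj', hi, hiq⟩
      rw [← key_of_box hb, h, rowMax_of_box hb]
    · rw [colMax_top hβ hi hiq, initial_top hπ]
      have h1 : Finset.Icc 1 q = (Finset.Ioc 0 q).image id := by
        rw [Finset.image_id]; rfl
      rw [h1]
      exact rank_image (f := id) (strictMono_id.strictMonoOn _) hi hiq
  · intro h
    funext j i
    by_cases hb : IsBox n lam j i
    · rw [key_of_box hb, rowMax_of_box hb]
      exact h _ (isDivider_colLen hb.1 hb.2.1) i hb.2.2.1 hb.2.2.2
    · rw [key_of_not_box hb, rowMax_of_not_box hb]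

/-! ### Scanning -/

theorem scanLast_mono (T : ℕ → ℕ → ℕ) (c : ℕ → ℕ) (j : ℕ) : Monotone (scanLast T c j) := by
  apply monotone_nat_of_le_succ
  intro k
  simp only [scanLast]
  split_ifs with h
  · exact h.2
  · exact le_rfl

theorem scanLast_one {T : ℕ → ℕ → ℕ} {c : ℕ → ℕ} {j : ℕ} (h : 0 < c j) :
    scanLast T c j 1 = T j (c j) := by
  simp [scanLast, h]

theorem scanLast_mem {T : ℕ → ℕ → ℕ} {c : ℕ → ℕ} {j : ℕ} (h : 0 < c j) (k : ℕ) :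
    ∃ l, j ≤ l ∧ 0 < c l ∧ scanLast T c j (k + 1) = T l (c l) := by
  induction k with
  | zero => exact ⟨j, le_rfl, h, scanLast_one h⟩
  | succ k ih =>
    rw [scanLast]
    split_ifs with h1
    · exact ⟨j + (k + 1), by omega, h1.1, rfl⟩
    · exact ih

theorem scanRemove_le (T : ℕ → ℕ → ℕ) (j : ℕ) (c : ℕ → ℕ) : scanRemove T j c ≤ c := by
  intro l
  simp only [scanRemove]
  split_ifs <;> omega

theorem scanRemove_start (T : ℕ → ℕ → ℕ) (j : ℕ) (c : ℕ → ℕ) :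
    scanRemove T j c j = c j - 1 := by
  simp only [scanRemove, le_refl, true_and, Nat.sub_self, scanLast, Nat.zero_le, and_true]
  split_ifs <;> omega

theorem scanLast_scanRemove_lt {T : ℕ → ℕ → ℕ} (hlam : lam ∈ Partitions n)
    (hT : T ∈ Tableaux n lam) {c : ℕ → ℕ} (hc : c ≤ colLen n lam) {j : ℕ} (hj : 1 ≤ j)
    (h : 0 < c j) (k : ℕ) :
    scanLast T (scanRemove T j c) j (k + 1) < scanLast T c j (k + 1) := by
  have hbox : ∀ l i, j ≤ l → 1 ≤ i → i ≤ c l → IsBox n lam l i := fun l i h1 h2 h3 =>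
    isBox_of_le_colLen hlam (hj.trans h1) h2 (h3.trans (hc l))
  have hdec : ∀ l, j ≤ l → 0 < c l - 1 → T l (c l - 1) < T l (c l) := fun l h1 h2 =>
    hT.2.2.1 l _ _ (hbox l _ h1 h2 (by omega)) (hbox l _ h1 (by omega) le_rfl) (by omega)
  induction k with
  | zero =>
    rw [Nat.zero_add, scanLast_one h]
    simp only [scanLast, Nat.add_zero, scanRemove_start, Nat.zero_le, and_true]
    split_ifs with h1
    · exact hdec j le_rfl h1
    · have := Finset.mem_Icc.1 (hT.1 j (c j) (hbox j _ le_rfl h le_rfl))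
      omega
  | succ k ih =>
    have hs : ∀ d, scanLast T d j (k + 1 + 1) =
        if 0 < d (j + (k + 1)) ∧ scanLast T d j (k + 1) ≤ T (j + (k + 1)) (d (j + (k + 1))) then
          T (j + (k + 1)) (d (j + (k + 1))) else scanLast T d j (k + 1) := fun _ => rfl
    rw [hs, hs]
    have hr : scanRemove T j c (j + (k + 1)) =
        if 0 < c (j + (k + 1)) ∧ scanLast T c j (k + 1) ≤ T (j + (k + 1)) (c (j + (k + 1))) then
          c (j + (k + 1)) - 1 else c (j + (k + 1)) := by
      simp only [scanRemove]
      rw [show j + (k + 1) - j = k + 1 by omega]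
      simp only [show j ≤ j + (k + 1) by omega, true_and]
    rw [hr]
    by_cases h1 : 0 < c (j + (k + 1)) ∧
        scanLast T c j (k + 1) ≤ T (j + (k + 1)) (c (j + (k + 1)))
    · rw [if_pos h1, if_pos h1]
      split_ifs with h2
      · exact hdec _ (by omega) h2.1
      · omega
    · rw [if_neg h1, if_neg h1]
      split_ifs with h2
      · by_contra h3
        exact h1 ⟨h2.1, not_lt.1 h3⟩
      · exact ih

theorem scanRemove_antitone {T : ℕ → ℕ → ℕ} (hlam : lam ∈ Partitions n)
    (hT : T ∈ Tableaux n lam) {c : ℕ → ℕ} (hc : c ≤ colLen n lam) {j : ℕ} (hj : 1 ≤ j)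
    (h : ∀ l, j ≤ l → c (l + 1) ≤ c l) (l : ℕ) (hl : j ≤ l) :
    scanRemove T j c (l + 1) ≤ scanRemove T j c l := by
  have h1 := h l hl
  have h2 : scanRemove T j c (l + 1) ≤ c (l + 1) := scanRemove_le T j c (l + 1)
  by_cases hsel : 0 < c l ∧ scanLast T c j (l - j) ≤ T l (c l)
  · have h3 : scanRemove T j c l = c l - 1 := if_pos ⟨hl, hsel⟩
    rw [h3]
    rcases eq_or_lt_of_le h1 with h4 | h4
    · have h5 : scanLast T c j (l + 1 - j) = T l (c l) := by
        rw [show l + 1 - j = (l - j) + 1 by omega]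
        rw [scanLast, show j + (l - j) = l by omega]
        exact if_pos hsel
      have h6 : T l (c l) ≤ T (l + 1) (c l) :=
        hT.2.2.2 l (l + 1) (c l) (isBox_of_le_colLen hlam (by omega) hsel.1 (hc l))
          (isBox_of_le_colLen hlam (by omega) hsel.1 (by rw [← h4]; exact hc _)) (by omega)
      have h7 : scanRemove T j c (l + 1) = c (l + 1) - 1 :=
        if_pos ⟨by omega, by omega, by rw [h5, h4]; exact h6⟩
      omega
    · omega
  · have h3 : scanRemove T j c l = c l := if_neg (fun h4 => hsel h4.2)
    omega

theorem scan_iterate_le (T : ℕ → ℕ → ℕ) (j : ℕ) (c : ℕ → ℕ) (s : ℕ) :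
    (scanRemove T j)^[s] c ≤ c := by
  induction s with
  | zero => exact le_rfl
  | succ s ih =>
    rw [Function.iterate_succ_apply']
    exact (scanRemove_le T j _).trans ih

theorem scan_iterate_start (T : ℕ → ℕ → ℕ) (j : ℕ) (c : ℕ → ℕ) (s : ℕ) :
    (scanRemove T j)^[s] c j = c j - s := by
  induction s with
  | zero => rfl
  | succ s ih =>
    rw [Function.iterate_succ_apply', scanRemove_start, ih]
    omega

theorem scan_iterate_antitone {T : ℕ → ℕ → ℕ} (hlam : lam ∈ Partitions n)
    (hT : T ∈ Tableaux n lam) {j : ℕ} (hj : 1 ≤ j) (s : ℕ) :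
    ∀ l, j ≤ l → (scanRemove T j)^[s] (colLen n lam) l ≤
      (scanRemove T j)^[s] (colLen n lam) j := by
  have key : ∀ l, j ≤ l → (scanRemove T j)^[s] (colLen n lam) (l + 1) ≤
      (scanRemove T j)^[s] (colLen n lam) l := by
    induction s with
    | zero => exact fun l _ => colLen_anti n lam (by omega)
    | succ s ih =>
      rw [Function.iterate_succ_apply']
      exact scanRemove_antitone hlam hT (scan_iterate_le T j _ s) hj ih
  intro l hl
  induction l, hl using Nat.le_induction with
  | base => exact le_rfl
  | succ l hl ih => exact (key l hl).trans ih

theorem scan_of_box {T : ℕ → ℕ → ℕ} {j i : ℕ} (h : IsBox n lam j i) :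
    scan n lam T j i = scanLast T ((scanRemove T j)^[colLen n lam j - i] (colLen n lam)) j
      (lam 1 - j + 1) := by
  have := h.2.1
  simp only [scan]
  rw [if_pos h, show lam 1 + 1 - j = lam 1 - j + 1 by omega]

theorem scan_of_not_box {T : ℕ → ℕ → ℕ} {j i : ℕ} (h : ¬ IsBox n lam j i) :
    scan n lam T j i = 0 := if_neg h

theorem scan_start {T : ℕ → ℕ → ℕ} {j i : ℕ} (h : IsBox n lam j i) :
    (scanRemove T j)^[colLen n lam j - i] (colLen n lam) j = i := by
  rw [scan_iterate_start]
  have := h.2.2.2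
  omega

theorem scan_strictMonoOn {T : ℕ → ℕ → ℕ} (hlam : lam ∈ Partitions n)
    (hT : T ∈ Tableaux n lam) {j : ℕ} (hj : 1 ≤ j) (hj' : j ≤ lam 1) :
    StrictMonoOn (scan n lam T j) (Finset.Ioc 0 (colLen n lam j)) := by
  have hstep : ∀ i, 1 ≤ i → i + 1 ≤ colLen n lam j →
      scan n lam T j i < scan n lam T j (i + 1) := by
    intro i h1 h2
    have hb : IsBox n lam j i := ⟨hj, hj', h1, by omega⟩
    have hb' : IsBox n lam j (i + 1) := ⟨hj, hj', by omega, h2⟩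
    rw [scan_of_box hb, scan_of_box hb',
      show colLen n lam j - i = (colLen n lam j - (i + 1)) + 1 by omega,
      Function.iterate_succ_apply']
    exact scanLast_scanRemove_lt hlam hT (scan_iterate_le T j _ _) hj
      (by rw [scan_start hb']; omega) _
  intro i hi k hk hik
  rw [Finset.coe_Ioc, Set.mem_Ioc] at hi hk
  induction k, (show i + 1 ≤ k from hik) using Nat.le_induction with
  | base => exact hstep i hi.1 hk.2
  | succ k h1 ih => exact (ih ⟨by omega, by omega⟩ h1).trans (hstep k (by omega) hk.2)

theorem scan_mem {T : ℕ → ℕ → ℕ} (hlam : lam ∈ Partitions n)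
    (hT : T ∈ Tableaux n lam) {j i : ℕ} (h : IsBox n lam j i) :
    ∃ l k, j ≤ l ∧ k ≤ i ∧ IsBox n lam l k ∧ scan n lam T j i = T l k := by
  rw [scan_of_box h]
  obtain ⟨l, h1, h2, h3⟩ := scanLast_mem (T := T)
    (c := (scanRemove T j)^[colLen n lam j - i] (colLen n lam)) (j := j)
    (by rw [scan_start h]; exact h.2.2.1) (lam 1 - j)
  refine ⟨l, _, h1, ?_, ?_, h3⟩
  · have := scan_iterate_antitone hlam hT h.1 (colLen n lam j - i) l h1
    rwa [scan_start h] at this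
  · exact isBox_of_le_colLen hlam (h.1.trans h1) h2 (scan_iterate_le T j _ _ l)

theorem le_scan {T : ℕ → ℕ → ℕ} (hT : T ∈ Tableaux n lam) : T ≤ scan n lam T := by
  intro j i
  by_cases h : IsBox n lam j i
  · rw [scan_of_box h]
    refine le_trans ?_ (scanLast_mono _ _ _ (show 1 ≤ lam 1 - j + 1 by omega))
    rw [scanLast_one (by rw [scan_start h]; exact h.2.2.1), scan_start h]
  · rw [hT.2.1 j i h]; exact Nat.zero_le _

theorem scan_key {π : ℕ → ℕ} (hlam : lam ∈ Partitions n) (hπ : π ∈ RPerm n R) :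
    scan n lam (key n lam π) = key n lam π := by
  have hT := key_mem_tableaux (lam := lam) hπ
  funext j i
  by_cases h : IsBox n lam j i
  · have hm := scan_strictMonoOn hlam hT h.1 h.2.1
    have himg : (Finset.Ioc 0 (colLen n lam j)).image (scan n lam (key n lam π) j) =
        initial π (colLen n lam j) := by
      apply Finset.eq_of_subset_of_card_le
      · intro x hx
        obtain ⟨k, hk, rfl⟩ := Finset.mem_image.1 hx
        rw [Finset.mem_Ioc] at hk
        obtain ⟨l, m, h1, -, h2, h3⟩ := scan_mem hlam hT (⟨h.1, h.2.1, hk⟩ : IsBox n lam j k)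
        rw [h3]
        exact initial_subset (colLen_anti n lam h1) (key_mem_initial hπ h2)
      · rw [Finset.card_image_of_injOn hm.injOn, card_initial hπ (colLen_le n lam j)]
        simp
    rw [← rank_image hm h.2.2.1 h.2.2.2, himg, key_of_box h]
  · rw [scan_of_not_box h, key_of_not_box h]

/-! ### Demazure sets and row bound sets -/

theorem key_mem_demazureSet {π : ℕ → ℕ} (hlam : lam ∈ Partitions n) (hπ : π ∈ RPerm n R) :
    key n lam π ∈ DemazureSet n lam π :=
  ⟨key_mem_tableaux hπ, (scan_key hlam hπ).le⟩

theorem le_key_of_mem {π : ℕ → ℕ} {T : ℕ → ℕ → ℕ} (hT : T ∈ DemazureSet n lam π) :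
    T ≤ key n lam π := (le_scan hT.1).trans hT.2

theorem demazureSet_eq_of_upperFlag {φ π : ℕ → ℕ} (hlam : lam ∈ Partitions n)
    (hφ : φ ∈ UpperFlag n) (h : key n lam π = rowMax n lam φ) :
    DemazureSet n lam π = RowBoundSet n lam φ := by
  ext T
  constructor
  · intro hT
    rw [mem_rowBoundSet_iff hφ.1, ← h]
    exact ⟨hT.1, le_key_of_mem hT⟩
  · intro hT
    refine ⟨hT.1, ?_⟩
    rw [h]
    refine le_rowMax hφ.1 (fun j i => scan_of_not_box)
      (fun j hj hj' => scan_strictMonoOn hlam hT.1 hj hj') fun j i hb => ?_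
    obtain ⟨l, k, -, h2, h3, h4⟩ := scan_mem hlam hT.1 hb
    rw [h4]
    have hn := colLen_le n lam j
    have := hb.2.2
    have := h3.2.2.1
    exact (hT.2.2 l k h3).trans (hφ.2 ⟨h3.2.2.1, by omega⟩ ⟨hb.2.2.1, by omega⟩ h2)

theorem key_eq_rowMax_of_eq {β π : ℕ → ℕ} (hlam : lam ∈ Partitions n) (hβ : β ∈ Upper n)
    (hπ : π ∈ RPerm n R) (h : RowBoundSet n lam β = DemazureSet n lam π) :
    key n lam π = rowMax n lam β :=
  le_antisymm (le_rowMax_of_mem hβ (h ▸ key_mem_demazureSet hlam hπ))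
    (le_key_of_mem (h ▸ rowMax_mem_rowBoundSet hβ))

theorem scan_ge_of_skip {T : ℕ → ℕ → ℕ} {j k v : ℕ} (hb : IsBox n lam j k)
    (hj : j + 1 ≤ lam 1) (hle : ∀ l i, j < l → T l i ≤ v)
    (hgt : ∀ r, k < r → r ≤ colLen n lam j → v < T j r)
    (hpos : 0 < colLen n lam (j + 1)) (hv : T (j + 1) (colLen n lam (j + 1)) = v)
    (hk : T j k ≤ v) : v ≤ scan n lam T j k := by
  have key : ∀ s, s ≤ colLen n lam j - k → ∀ l, j < l →
      (scanRemove T j)^[s] (colLen n lam) l = colLen n lam l := by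
    intro s
    induction s with
    | zero => exact fun _ l _ => rfl
    | succ s ih =>
      intro hs l hl
      rw [Function.iterate_succ_apply']
      rw [← ih (by omega) l hl]
      refine if_neg ?_
      rintro ⟨-, -, h3⟩
      have hst := scan_iterate_start T j (colLen n lam) s
      have h4 := scanLast_mono T ((scanRemove T j)^[s] (colLen n lam)) j
        (show 1 ≤ l - j by omega)
      rw [scanLast_one (by omega), hst] at h4
      have h5 := hgt (colLen n lam j - s) (by omega) (by omega)
      have h6 := hle l ((scanRemove T j)^[s] (colLen n lam) l) hl
      omega
  rw [scan_of_box hb]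
  refine le_trans ?_ (scanLast_mono _ _ _ (show 2 ≤ lam 1 - j + 1 by omega))
  rw [scanLast, key _ le_rfl (j + 1) (by omega), hv, scanLast_one (by
    rw [scan_start hb]; exact hb.2.2.1), scan_start hb, if_pos ⟨hpos, hk⟩]

theorem exists_adjacent_columns {q : ℕ} (hq : q ∈ shapeR n lam) (hqn : q < n)
    (hq' : carrelEnd n (shapeR n lam) (q + 1) ∈ shapeR n lam) :
    ∃ j, 1 ≤ j ∧ j + 1 ≤ lam 1 ∧ colLen n lam j = carrelEnd n (shapeR n lam) (q + 1) ∧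
      colLen n lam (j + 1) = q := by
  obtain ⟨j₁, h1, h1', h1q⟩ := exists_colLen_eq hq
  obtain ⟨j₂, h2, h2', h2q⟩ := exists_colLen_eq hq'
  have hqe := (carrelEnd_spec (R := shapeR n lam) (n := n) (i := q + 1) hqn).2
  have hex : ∃ j, colLen n lam j ≤ q := ⟨j₁, h1q.le⟩
  have hf := Nat.find_spec hex
  have hmin : Nat.find hex ≤ j₁ := Nat.find_min' hex h1q.le
  have hlt : j₂ < Nat.find hex := by
    by_contra hcon
    have := colLen_anti n lam (not_lt.1 hcon)
    omega
  refine ⟨Nat.find hex - 1, by omega, by omega, ?_, ?_⟩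
  · apply le_antisymm
    · rw [← h2q]
      exact colLen_anti n lam (by omega)
    · have h3 := Nat.find_min hex (m := Nat.find hex - 1) (by omega)
      exact carrelEnd_le (isDivider_colLen (by omega) (by omega)) (by omega)
  · rw [show Nat.find hex - 1 + 1 = Nat.find hex by omega]
    have := colLen_anti n lam hmin
    omega

theorem core_mem_gapless_of_scan_le {β : ℕ → ℕ} (hn : 1 ≤ n) (hβ : β ∈ Upper n)
    (h : ∀ T ∈ RowBoundSet n lam β, scan n lam T ≤ rowMax n lam β) :
    core n (shapeR n lam) β ∈ Gapless n (shapeR n lam) := by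
  classical
  have hR := shapeR_bounds (lam := lam) hn
  have hγ := core_mem_upperIncreasing hR hβ
  refine mem_gapless_of hR hγ fun q hq v h1 h2 => ?_
  by_contra hno
  push Not at hno
  obtain ⟨hq1, hqn⟩ := hR q hq
  obtain ⟨hdiv, hqe⟩ := carrelEnd_spec (R := shapeR n lam) (n := n) (i := q + 1) hqn
  have hen := carrelEnd_le_top (R := shapeR n lam) (n := n) (i := q + 1) hqn
  have hval : ∀ k, q < k → k ≤ carrelEnd n (shapeR n lam) (q + 1) →
      colMax β (carrelEnd n (shapeR n lam) (q + 1)) k = core n (shapeR n lam) β k := by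
    intro k hk1 hk2
    rw [core_eq_colMax hR hβ (by omega) (by omega),
      carrelEnd_eq_of_carrel (i := q + 1) (by rw [carrelStart_succ hq]; exact hk1) hk2 hqn]
  have hvq : v ≤ β q := by
    rwa [core_eq_colMax hR hβ hq1 hqn.le, carrelEnd_of_isDivider hR (Or.inl hq),
      colMax_self] at h2
  have hvn : v ≤ n := hvq.trans (upper_le_top hβ hq1 hqn.le)
  have hq' : carrelEnd n (shapeR n lam) (q + 1) ∈ shapeR n lam := by
    rcases hdiv with h3 | h3
    · exact h3
    · exfalso
      rw [← hval _ (by omega) hqe, h3, colMax_top hβ (by omega) hqn] at h1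
      refine hno v h1 (by omega) ?_
      rw [← hval v h1 (by omega), h3, colMax_top hβ (by omega) hvn]
  obtain ⟨j, hj, hj', hjq', hjq⟩ := exists_adjacent_columns hq hqn hq'
  set q' := carrelEnd n (shapeR n lam) (q + 1) with hqdef
  have hup : ∀ l, ∀ k, 1 ≤ k → k ≤ colLen n lam l → k ≤ β k := fun l =>
    upper_le hβ (colLen_le n lam l)
  have hup' := upper_le hβ hen
  have hlow : ∀ i, 1 ≤ i → i ≤ q → colMax β q' i < v := by
    intro i hi1 hi2
    have h3 := colMax_add_le_colMax (k := q + 1) hi1 hup' (by omega) hqe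
    rw [hval _ (by omega) hqe] at h3
    omega
  have hlen : ∀ l, l ≤ j → q' ≤ colLen n lam l := fun l hl => by
    rw [← hjq']; exact colLen_anti n lam hl
  have hlen' : ∀ l, j < l → colLen n lam l ≤ q := fun l hl => by
    rw [← hjq]; exact colLen_anti n lam hl
  let T : ℕ → ℕ → ℕ := fun l i =>
    if IsBox n lam l i then
      if l ≤ j then colMax β (colLen n lam l) i else if i < q then colMax β q' i else v
    else 0
  have hT1 : ∀ l i, IsBox n lam l i → l ≤ j → T l i = colMax β (colLen n lam l) i :=
    fun l i hb hl => by simp only [T]; rw [if_pos hb, if_pos hl]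
  have hT2 : ∀ l i, IsBox n lam l i → j < l → i < q → T l i = colMax β q' i :=
    fun l i hb hl hi => by simp only [T]; rw [if_pos hb, if_neg (by omega), if_pos hi]
  have hT3 : ∀ l i, IsBox n lam l i → j < l → ¬ i < q → T l i = v :=
    fun l i hb hl hi => by simp only [T]; rw [if_pos hb, if_neg (by omega), if_neg hi]
  have hTmem : T ∈ RowBoundSet n lam β := by
    have hbd : ∀ l i, IsBox n lam l i → i ≤ T l i ∧ T l i ≤ β i := by
      intro l i hb
      rcases le_or_gt l j with hl | hl
      · rw [hT1 l i hb hl]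
        exact ⟨le_colMax hb.2.2.1 hb.2.2.2 (hup l), colMax_le hb.2.2.1 hb.2.2.2 (hup l)⟩
      · have hi := hb.2.2.2.trans (hlen' l hl)
        by_cases hiq : i < q
        · rw [hT2 l i hb hl hiq]
          exact ⟨le_colMax hb.2.2.1 (by omega) hup', colMax_le hb.2.2.1 (by omega) hup'⟩
        · rw [hT3 l i hb hl hiq]
          obtain rfl : i = q := by omega
          have := upper_le hγ.1 (le_refl n) (i + 1) (by omega) (by omega)
          exact ⟨by omega, hvq⟩
    refine ⟨⟨?_, fun l i hb => if_neg hb, ?_, ?_⟩, hβ.2, fun l i hb => (hbd l i hb).2⟩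
    · intro l i hb
      have := hbd l i hb
      have := upper_le_top hβ hb.2.2.1 (hb.2.2.2.trans (colLen_le n lam l))
      have := hb.2.2.1
      rw [Finset.mem_Icc]
      omega
    · intro l i i' hb hb' hii
      rcases le_or_gt l j with hl | hl
      · rw [hT1 l i hb hl, hT1 l i' hb' hl]
        have := colMax_add_le_colMax hb.2.2.1 (hup l) hii.le hb'.2.2.2
        omega
      · have hi := hb'.2.2.2.trans (hlen' l hl)
        rw [hT2 l i hb hl (by omega)]
        by_cases hiq : i' < q
        · rw [hT2 l i' hb' hl hiq]
          have := colMax_add_le_colMax hb.2.2.1 hup' hii.le (by omega)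
          omega
        · rw [hT3 l i' hb' hl hiq]
          exact hlow i hb.2.2.1 (by omega)
    · intro l l' i hb hb' hll
      rcases le_or_gt l' j with hl' | hl'
      · rw [hT1 l i hb (by omega), hT1 l' i hb' hl']
        exact colMax_anti hb.2.2.1 hb'.2.2.2 (colLen_anti n lam hll) (hup l)
      · have hi := hb'.2.2.2.trans (hlen' l' hl')
        rcases le_or_gt l j with hl | hl
        · rw [hT1 l i hb hl]
          have h3 := colMax_anti hb.2.2.1 (by omega : i ≤ q') (hlen l hl) (hup l)
          by_cases hiq : i < q
          · rw [hT2 l' i hb' hl' hiq]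
            exact h3
          · rw [hT3 l' i hb' hl' hiq]
            exact h3.trans (hlow i hb.2.2.1 hi).le
        · by_cases hiq : i < q
          · rw [hT2 l i hb hl hiq, hT2 l' i hb' hl' hiq]
          · rw [hT3 l i hb hl hiq, hT3 l' i hb' hl' hiq]
  have hv1 : core n (shapeR n lam) β (q + 1) < v :=
    lt_of_le_of_ne h1 (hno (q + 1) (by omega) hqe)
  have hg := Nat.findGreatest_spec (P := fun k => core n (shapeR n lam) β k < v) hqe hv1
  have hg1 := Nat.le_findGreatest (P := fun k => core n (shapeR n lam) β k < v) hqe hv1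
  have hg2 := Nat.findGreatest_le (P := fun k => core n (shapeR n lam) β k < v) q'
  have hg3 : ∀ r, Nat.findGreatest (fun k => core n (shapeR n lam) β k < v) q' < r → r ≤ q' →
      ¬ core n (shapeR n lam) β r < v := fun r h3 h4 =>
    Nat.findGreatest_is_greatest (P := fun k => core n (shapeR n lam) β k < v) h3 h4
  set k := Nat.findGreatest (fun k => core n (shapeR n lam) β k < v) q' with hkdef
  have hbj : ∀ r, q < r → r ≤ q' → IsBox n lam j r ∧ T j r = core n (shapeR n lam) β r := by
    intro r h3 h4
    have hb : IsBox n lam j r := ⟨hj, by omega, by omega, by rw [hjq']; exact h4⟩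
    exact ⟨hb, by rw [hT1 j r hb le_rfl, hjq', hval r h3 h4]⟩
  obtain ⟨hbk, hTk⟩ := hbj k (by omega) hg2
  have hscan : v ≤ scan n lam T j k := by
    apply scan_ge_of_skip hbk hj'
    · intro l i hl
      by_cases hb : IsBox n lam l i
      · by_cases hiq : i < q
        · rw [hT2 l i hb hl hiq]
          exact (hlow i hb.2.2.1 hiq.le).le
        · rw [hT3 l i hb hl hiq]
      · simp only [T]
        rw [if_neg hb]
        exact Nat.zero_le _
    · intro r h3 h4
      rw [hjq'] at h4
      rw [(hbj r (by omega) h4).2]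
      exact lt_of_le_of_ne (not_lt.1 (hg3 r h3 h4)) (Ne.symm (hno r (by omega) h4))
    · omega
    · rw [hjq]
      exact hT3 (j + 1) q ⟨by omega, hj', hq1, hjq.ge⟩ (by omega) (by omega)
    · rw [hTk]; exact hg.le
  have hle := h T hTmem j k
  rw [rowMax_of_box hbk, hjq', hval k (by omega) hg2] at hle
  exact absurd (hscan.trans hle) (not_le.2 hg)

/-! ### The correspondence -/

theorem demazureSet_eq_of_keyEq {γ π : ℕ → ℕ} (hn : 1 ≤ n) (hlam : lam ∈ Partitions n)
    (hγ : γ ∈ Gapless n (shapeR n lam)) (hπ : π ∈ RPerm n (shapeR n lam))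
    (h : KeyEq n (shapeR n lam) γ π) :
    DemazureSet n lam π = RowBoundSet n lam (floorMap n (shapeR n lam) γ) := by
  have hR := shapeR_bounds (lam := lam) hn
  have hφ := floorMap_mem_upperFlag hR hγ
  apply demazureSet_eq_of_upperFlag hlam hφ
  rw [← rowMax_core hn hφ.1, core_floorMap hR hγ, key_eq_rowMax_iff hγ.1.1 hπ]
  exact h

theorem rowBoundSet_floorMap {γ : ℕ → ℕ} (hn : 1 ≤ n)
    (hγ : γ ∈ Gapless n (shapeR n lam)) :
    RowBoundSet n lam (floorMap n (shapeR n lam) γ) = RowBoundSet n lam γ := by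
  have hR := shapeR_bounds (lam := lam) hn
  rw [← rowBoundSet_core hn (floorMap_mem_upperFlag hR hγ).1, core_floorMap hR hγ]

theorem demazureSet_permOf {γ : ℕ → ℕ} (hn : 1 ≤ n) (hlam : lam ∈ Partitions n)
    (hγ : γ ∈ Gapless n (shapeR n lam)) :
    DemazureSet n lam (permOf n (shapeR n lam) γ) = RowBoundSet n lam γ := by
  have hR := shapeR_bounds (lam := lam) hn
  rw [demazureSet_eq_of_keyEq hn hlam hγ (permOf_mem_rperm hn hR hγ) (keyEq_permOf hn hR hγ),
    rowBoundSet_floorMap hn hγ]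

theorem demazureSet_eq_rankTuple {π : ℕ → ℕ} (hn : 1 ≤ n) (hlam : lam ∈ Partitions n)
    (hπ : π ∈ RPerm312 n (shapeR n lam)) :
    DemazureSet n lam π = RowBoundSet n lam (rankTuple n (shapeR n lam) π) := by
  have hR := shapeR_bounds (lam := lam) hn
  have hγ := rankTuple_mem_gapless hR hπ
  rw [demazureSet_eq_of_keyEq hn hlam hγ hπ.1 (keyEq_rankTuple hn hR hπ),
    rowBoundSet_floorMap hn hγ]

theorem keyEq_of_eq {β π : ℕ → ℕ} (hlam : lam ∈ Partitions n)
    (hβ : β ∈ Upper n) (hπ : π ∈ RPerm n (shapeR n lam))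
    (h : RowBoundSet n lam β = DemazureSet n lam π) : KeyEq n (shapeR n lam) β π :=
  (key_eq_rowMax_iff hβ hπ).1 (key_eq_rowMax_of_eq hlam hβ hπ h)

theorem core_mem_gapless_of_eq {β π : ℕ → ℕ} (hn : 1 ≤ n) (hlam : lam ∈ Partitions n)
    (hβ : β ∈ Upper n) (hπ : π ∈ RPerm n (shapeR n lam))
    (h : RowBoundSet n lam β = DemazureSet n lam π) :
    core n (shapeR n lam) β ∈ Gapless n (shapeR n lam) := by
  apply core_mem_gapless_of_scan_le hn hβ
  intro T hT
  rw [← key_eq_rowMax_of_eq hlam hβ hπ h]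
  rw [h] at hT
  exact hT.2

theorem eq_permOf_core_of_eq {β π : ℕ → ℕ} (hn : 1 ≤ n) (hlam : lam ∈ Partitions n)
    (hβ : β ∈ Upper n) (hπ : π ∈ RPerm n (shapeR n lam))
    (h : RowBoundSet n lam β = DemazureSet n lam π) :
    π = permOf n (shapeR n lam) (core n (shapeR n lam) β) := by
  have hR := shapeR_bounds (lam := lam) hn
  have hγ := core_mem_gapless_of_eq hn hlam hβ hπ h
  exact KeyEq.unique hR hπ (permOf_mem_rperm hn hR hγ) (keyEq_of_eq hlam hβ hπ h)
    ((KeyEq.of_core hR hβ).1 (keyEq_permOf hn hR hγ))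

theorem mem_rperm312_of_eq {β π : ℕ → ℕ} (hn : 1 ≤ n) (hlam : lam ∈ Partitions n)
    (hβ : β ∈ Upper n) (hπ : π ∈ RPerm n (shapeR n lam))
    (h : RowBoundSet n lam β = DemazureSet n lam π) : π ∈ RPerm312 n (shapeR n lam) := by
  rw [eq_permOf_core_of_eq hn hlam hβ hπ h]
  exact permOf_mem_rperm312 hn (shapeR_bounds hn) (core_mem_gapless_of_eq hn hlam hβ hπ h)

theorem rowBoundSet_eq_permOf_core {β : ℕ → ℕ} (hn : 1 ≤ n) (hlam : lam ∈ Partitions n)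
    (hβ : β ∈ GaplessCore n (shapeR n lam)) :
    RowBoundSet n lam β =
      DemazureSet n lam (permOf n (shapeR n lam) (core n (shapeR n lam) β)) := by
  rw [demazureSet_permOf hn hlam hβ.2, rowBoundSet_core hn hβ.1]

theorem isRowBoundMax_key {β π : ℕ → ℕ} (hlam : lam ∈ Partitions n)
    (hβ : β ∈ Upper n) (hπ : π ∈ RPerm n R)
    (h : RowBoundSet n lam β = DemazureSet n lam π) :
    IsRowBoundMax n lam β (key n lam π) := by
  rw [key_eq_rowMax_of_eq hlam hβ hπ h]
  have hmem := rowMax_mem_rowBoundSet (lam := lam) hβ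
  exact ⟨⟨hmem.1, fun T hT => le_rowMax_of_mem hβ hT⟩, fun Q hQ => hQ.2 hmem⟩

theorem image_upperFlag_eq (hn : 1 ≤ n) (hlam : lam ∈ Partitions n) :
    RowBoundSet n lam '' UpperFlag n = DemazureSet n lam '' RPerm312 n (shapeR n lam) := by
  have hR := shapeR_bounds (lam := lam) hn
  ext S
  constructor
  · rintro ⟨φ, hφ, rfl⟩
    have hγ := core_mem_gapless_of_upperFlag hR hφ
    exact ⟨_, permOf_mem_rperm312 hn hR hγ, (rowBoundSet_eq_permOf_core hn hlam ⟨hφ.1, hγ⟩).symm⟩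
  · rintro ⟨π, hπ, rfl⟩
    have hγ := rankTuple_mem_gapless hR hπ
    refine ⟨_, floorMap_mem_upperFlag hR hγ, ?_⟩
    rw [rowBoundSet_floorMap hn hγ, demazureSet_eq_rankTuple hn hlam hπ]

theorem bijOn_rowBoundSet (hn : 1 ≤ n) :
    Set.BijOn (RowBoundSet n lam) (Gapless n (shapeR n lam))
      (RowBoundSet n lam '' UpperFlag n) := by
  have hR := shapeR_bounds (lam := lam) hn
  refine ⟨fun γ hγ => ⟨_, floorMap_mem_upperFlag hR hγ, rowBoundSet_floorMap hn hγ⟩, ?_, ?_⟩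
  · intro γ hγ γ' hγ' h
    have := core_eq_of_rowBoundSet_eq hn hγ.1.1 hγ'.1.1 h
    rwa [core_eq_self hR hγ.1, core_eq_self hR hγ'.1] at this
  · rintro _ ⟨φ, hφ, rfl⟩
    exact ⟨_, core_mem_gapless_of_upperFlag hR hφ, rowBoundSet_core hn hφ.1⟩

end DemazureRowBound

theorem mainTheorem3 (n : ℕ) (hn : 1 ≤ n) (lam : ℕ → ℕ) (hlam : lam ∈ Partitions n)
    (R : Finset ℕ) (hR : R = shapeR n lam) :
    -- summary
    (∀ β ∈ Upper n,
      (∃ π ∈ RPerm n R, RowBoundSet n lam β = DemazureSet n lam π) ↔ core n R β ∈ Gapless n R) ∧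
    (∀ φ ∈ UpperFlag n, ∃ π ∈ RPerm n R, RowBoundSet n lam φ = DemazureSet n lam π) ∧
    (∀ β ∈ Upper n,
      (∃ π ∈ RPerm n R, RowBoundSet n lam β = DemazureSet n lam π) ↔
        ∃ φ ∈ UpperFlag n, RowBoundSet n lam β = RowBoundSet n lam φ) ∧
    (∀ π ∈ RPerm n R,
      (∃ β ∈ Upper n, DemazureSet n lam π = RowBoundSet n lam β) ↔ π ∈ RPerm312 n R) ∧
    -- (i)
    (∀ β ∈ GaplessCore n R,
      permOf n R (core n R β) ∈ RPerm312 n R ∧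
      RowBoundSet n lam β = DemazureSet n lam (permOf n R (core n R β)) ∧
      ∀ π ∈ RPerm n R, RowBoundSet n lam β = DemazureSet n lam π → π = permOf n R (core n R β)) ∧
    -- (ii)
    (∀ π ∈ RPerm312 n R,
      rankTuple n R π ∈ Gapless n R ∧
      DemazureSet n lam π = RowBoundSet n lam (rankTuple n R π) ∧
      ∀ β ∈ Upper n, DemazureSet n lam π = RowBoundSet n lam β →
        core n R β = rankTuple n R π ∧ β ∈ GaplessCore n R) ∧
    -- (iii)
    (∀ β ∈ Upper n, ∀ π ∈ RPerm n R, RowBoundSet n lam β = DemazureSet n lam π →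
      IsRowBoundMax n lam β (key n lam π) ∧ core n R β = rankTuple n R π ∧
      β ∈ GaplessCore n R ∧ π ∈ RPerm312 n R) ∧
    -- (iv)
    RowBoundSet n lam '' UpperFlag n = DemazureSet n lam '' RPerm312 n R ∧
    (∀ γ ∈ Gapless n R,
      floorMap n R γ ∈ FloorFlag n R ∧ permOf n R γ ∈ RPerm312 n R ∧
      RowBoundSet n lam (floorMap n R γ) = DemazureSet n lam (permOf n R γ)) ∧
    Set.BijOn (fun γ => RowBoundSet n lam (floorMap n R γ)) (Gapless n R)
      (RowBoundSet n lam '' UpperFlag n) ∧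
    Set.BijOn (fun γ => DemazureSet n lam (permOf n R γ)) (Gapless n R)
      (DemazureSet n lam '' RPerm312 n R) := by
  subst hR
  have hR := shapeR_bounds (lam := lam) hn
  have hflag : ∀ φ ∈ UpperFlag n,
      ∃ π ∈ RPerm n (shapeR n lam), RowBoundSet n lam φ = DemazureSet n lam π := fun φ hφ =>
    have hγ := core_mem_gapless_of_upperFlag hR hφ
    ⟨_, permOf_mem_rperm hn hR hγ, rowBoundSet_eq_permOf_core hn hlam ⟨hφ.1, hγ⟩⟩
  have hdem := fun γ (hγ : γ ∈ Gapless n (shapeR n lam)) => demazureSet_permOf hn hlam hγ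
  refine ⟨fun β hβ => ⟨?_, fun h => ?_⟩, hflag, fun β hβ => ⟨?_, ?_⟩, fun π hπ => ⟨?_, fun h => ?_⟩,
    fun β hβ => ⟨?_, ?_, ?_⟩, fun π hπ => ⟨?_, ?_, fun β hβ h => ?_⟩, fun β hβ π hπ h => ?_,
    image_upperFlag_eq hn hlam, fun γ hγ => ⟨?_, ?_, ?_⟩, ?_, ?_⟩
  · rintro ⟨π, hπ, h⟩
    exact core_mem_gapless_of_eq hn hlam hβ hπ h
  · exact ⟨_, permOf_mem_rperm hn hR h, rowBoundSet_eq_permOf_core hn hlam ⟨hβ, h⟩⟩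
  · rintro ⟨π, hπ, h⟩
    have hγ := core_mem_gapless_of_eq hn hlam hβ hπ h
    exact ⟨_, floorMap_mem_upperFlag hR hγ,
      by rw [rowBoundSet_floorMap hn hγ, rowBoundSet_core hn hβ]⟩
  · rintro ⟨φ, hφ, h⟩
    rw [h]
    exact hflag φ hφ
  · rintro ⟨β, hβ, h⟩
    exact mem_rperm312_of_eq hn hlam hβ hπ h.symm
  · exact ⟨_, (rankTuple_mem_gapless hR h).1.1, demazureSet_eq_rankTuple hn hlam h⟩
  · exact permOf_mem_rperm312 hn hR hβ.2
  · exact rowBoundSet_eq_permOf_core hn hlam hβ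
  · exact fun π hπ h => eq_permOf_core_of_eq hn hlam hβ.1 hπ h
  · exact rankTuple_mem_gapless hR hπ
  · exact demazureSet_eq_rankTuple hn hlam hπ
  · exact ⟨(keyEq_of_eq hlam hβ hπ.1 h.symm).core_eq_rankTuple hR hβ, hβ,
      core_mem_gapless_of_eq hn hlam hβ hπ.1 h.symm⟩
  · exact ⟨isRowBoundMax_key hlam hβ hπ h, (keyEq_of_eq hlam hβ hπ h).core_eq_rankTuple hR hβ,
      ⟨hβ, core_mem_gapless_of_eq hn hlam hβ hπ h⟩, mem_rperm312_of_eq hn hlam hβ hπ h⟩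
  · exact floorMap_mem_floorFlag hR hγ
  · exact permOf_mem_rperm312 hn hR hγ
  · rw [hdem γ hγ, rowBoundSet_floorMap hn hγ]
  · exact (bijOn_rowBoundSet hn).congr fun γ hγ => (rowBoundSet_floorMap hn hγ).symm
  · rw [← image_upperFlag_eq hn hlam]
    exact (bijOn_rowBoundSet hn).congr fun γ hγ => (hdem γ hγ).symm
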